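/- Let $0<r_1<r_2<r_3<r_4$, let $\Omega=\{x\in\mathbb R^3:|x|<r_4\}$, and put $\Omega_1=\{0<|x|<r_1\}$, $\Omega_2=\{r_1<|x|<r_2\}$, $\Omega_3=\{r_2<|x|<r_3\}$, $\Omega_4=\{r_3<|x|<r_4\}$. Let $T>0$, $R_\alpha,R_m\in\mathbb R$, $\sigma\ge 0$. Let the magnetic diffusivity $\beta$ be smooth on each $\Omega_i$ with $0<\beta_0\le\beta\le\beta_M$ there. Let $f\in H^1(0,T;L^\infty(\Omega))$ be supported in $\Omega_3$ and $u\in H^1(0,T;L^\infty(\Omega)^3)$ be supported in $\Omega_2$ (for a.e. $t$, they vanish a.e. outside these regions). Let $B_0\in L^2(\Omega)^3$ with $\nabla\cdot B_0=0$ in $\Omega$ in the sense of distributions. Let $V=H_0(\mathbf{curl};\Omega)=\{A\in L^2(\Omega)^3:\ \nabla\times A\in L^2(\Omega)^3,\ A\times n=0\text{ on }\partial\Omega\}$ with the graph norm, and let $U=V'$ be its dual, $V\subset L^2(\Omega)^3\subset U$; $(\cdot,\cdot)$ denotes the $L^2(\Omega)$ inner product and $\langle\cdot,\cdot\rangle$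 the pairing of $U$ and $V$. Then there exists a unique $B\in L^2(0,T;V)$ with weak time derivative $B'\in L^2(0,T;U)$ such that, for a.e. $t\in(0,T)$ and all $A\in V$, $$\langle B',A\rangle+(\beta\,\nabla\times B,\nabla\times A)=R_\alpha\Big(\frac{f}{1+\sigma|B|^2}B,\nabla\times A\Big)+R_m\,(u\times B,\nabla\times A),$$ and $B(\cdot,0)=B_0$, where the initial value is that of the representative of $B$ in $C([0,T];L^2(\Omega)^3)$. -/

import Mathlib

open MeasureTheory Set
open scoped ContDiff ENNReal

noncomputable section

namespace Dynamo

/-- Euclidean three-space. -/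
abbrev E3 : Type := EuclideanSpace ℝ (Fin 3)

/-- The classical partial derivative `∂_j φ_k` of a vector field. -/
def partialD (φ : E3 → E3) (j k : Fin 3) (x : E3) : ℝ :=
  (fderiv ℝ φ x (EuclideanSpace.single j 1)) k

/-- The classical curl of a (smooth) vector field. -/
def classicalCurl (φ : E3 → E3) (x : E3) : E3 :=
  !₂[partialD φ 1 2 x - partialD φ 2 1 x,
     partialD φ 2 0 x - partialD φ 0 2 x,
     partialD φ 0 1 x - partialD φ 1 0 x]

/-- The vector product of `ℝ³`. -/
def cross (a b : E3) : E3 :=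
  WithLp.toLp 2 (crossProduct (WithLp.ofLp a) (WithLp.ofLp b))

/-- `L²(Ω)³`. -/
abbrev L2 (Ω : Set E3) : Type := Lp E3 2 (volume.restrict Ω)

/-- `C = ∇ × A` in the sense of distributions on `Ω`. -/
def HasWeakCurl (Ω : Set E3) (A C : L2 Ω) : Prop :=
  ∀ φ : E3 → E3, ContDiff ℝ ∞ φ → HasCompactSupport φ → tsupport φ ⊆ Ω →
    ∫ x in Ω, inner ℝ (C x) (φ x) = ∫ x in Ω, inner ℝ (A x) (classicalCurl φ x)

/-- `A × n = 0` on `∂Ω`, where `C = ∇ × A`: the tangential trace functional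
`φ ↦ (∇ × A, φ) - (A, ∇ × φ)` of Green's formula vanishes on all smooth fields `φ` on the closure
of `Ω` (restrictions to `Ω` of test fields on the whole space). -/
def HasZeroTangentialTrace (Ω : Set E3) (A C : L2 Ω) : Prop :=
  ∀ φ : E3 → E3, ContDiff ℝ ∞ φ → HasCompactSupport φ →
    (∫ x in Ω, inner ℝ (C x) (φ x)) - ∫ x in Ω, inner ℝ (A x) (classicalCurl φ x) = 0

theorem continuous_partialD {φ : E3 → E3} (h : ContDiff ℝ ∞ φ) (j k : Fin 3) :
    Continuous (partialD φ j k) := by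
  have h1 : Continuous (fderiv ℝ φ) := h.continuous_fderiv (by simp)
  unfold partialD
  fun_prop

theorem continuous_classicalCurl {φ : E3 → E3} (h : ContDiff ℝ ∞ φ) :
    Continuous (classicalCurl φ) := by
  have h1 := continuous_partialD h
  have h2 : Continuous fun x => ![partialD φ 1 2 x - partialD φ 2 1 x,
     partialD φ 2 0 x - partialD φ 0 2 x,
     partialD φ 0 1 x - partialD φ 1 0 x] := by
    refine continuous_pi fun i => ?_
    fin_cases i
    · exact (h1 1 2).sub (h1 2 1)
    · exact (h1 2 0).sub (h1 0 2)
    · exact (h1 0 1).sub (h1 1 0)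
  exact (PiLp.continuous_toLp 2 _).comp h2

theorem hasCompactSupport_classicalCurl {φ : E3 → E3} (h : HasCompactSupport φ) :
    HasCompactSupport (classicalCurl φ) := by
  refine (h.fderiv (𝕜 := ℝ)).mono fun x hx => ?_
  rw [Function.mem_support] at hx ⊢
  intro h0
  apply hx
  ext i
  fin_cases i <;> simp [classicalCurl, partialD, h0]

theorem integrable_inner_test {Ω : Set E3} (A : L2 Ω) {ψ : E3 → E3} (hc : Continuous ψ)
    (hs : HasCompactSupport ψ) :
    Integrable (fun x => inner ℝ (A x) (ψ x)) (volume.restrict Ω) := by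
  have hψ : MemLp ψ 2 (volume.restrict Ω) := hc.memLp_of_hasCompactSupport hs
  refine (L2.integrable_inner (𝕜 := ℝ) A hψ.toLp).congr ?_
  filter_upwards [hψ.coeFn_toLp] with x hx
  rw [hx]

theorem integral_inner_add {Ω : Set E3} (A A' : L2 Ω) {ψ : E3 → E3} (hc : Continuous ψ)
    (hs : HasCompactSupport ψ) :
    ∫ x in Ω, inner ℝ ((A + A' : L2 Ω) x) (ψ x)
      = (∫ x in Ω, inner ℝ (A x) (ψ x)) + ∫ x in Ω, inner ℝ (A' x) (ψ x) := by
  rw [← integral_add (integrable_inner_test A hc hs) (integrable_inner_test A' hc hs)]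
  refine integral_congr_ae ?_
  filter_upwards [Lp.coeFn_add A A'] with x hx
  rw [hx, Pi.add_apply, inner_add_left]

theorem integral_inner_smul {Ω : Set E3} (c : ℝ) (A : L2 Ω) (ψ : E3 → E3) :
    ∫ x in Ω, inner ℝ ((c • A : L2 Ω) x) (ψ x) = c * ∫ x in Ω, inner ℝ (A x) (ψ x) := by
  rw [← integral_const_mul]
  refine integral_congr_ae ?_
  filter_upwards [Lp.coeFn_smul c A] with x hx
  rw [hx, Pi.smul_apply, real_inner_smul_left]

theorem integral_inner_zero {Ω : Set E3} (ψ : E3 → E3) :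
    ∫ x in Ω, inner ℝ ((0 : L2 Ω) x) (ψ x) = 0 := by
  have h := integral_inner_smul (Ω := Ω) 0 0 ψ
  simpa using h

/-- `H₀(curl; Ω)`, realised as the space of pairs `(A, ∇ × A)` inside the Hilbert sum
`L²(Ω)³ ⊕ L²(Ω)³`, whose norm is the graph norm. -/
def H0curlSubmodule (Ω : Set E3) : Submodule ℝ (WithLp 2 (L2 Ω × L2 Ω)) where
  carrier := {p | HasWeakCurl Ω p.fst p.snd ∧ HasZeroTangentialTrace Ω p.fst p.snd}
  zero_mem' := by
    constructor
    · intro φ _ _ _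
      simp only [WithLp.zero_fst, WithLp.zero_snd, integral_inner_zero]
    · intro φ _ _
      simp only [WithLp.zero_fst, WithLp.zero_snd, integral_inner_zero, sub_zero]
  add_mem' := by
    rintro p q ⟨hp, hp'⟩ ⟨hq, hq'⟩
    constructor
    · intro φ h1 h2 h3
      rw [WithLp.add_fst, WithLp.add_snd, integral_inner_add _ _ h1.continuous h2,
        integral_inner_add _ _ (continuous_classicalCurl h1) (hasCompactSupport_classicalCurl h2),
        hp φ h1 h2 h3, hq φ h1 h2 h3]
    · intro φ h1 h2
      rw [WithLp.add_fst, WithLp.add_snd, integral_inner_add _ _ h1.continuous h2,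
        integral_inner_add _ _ (continuous_classicalCurl h1) (hasCompactSupport_classicalCurl h2)]
      linarith [hp' φ h1 h2, hq' φ h1 h2]
  smul_mem' := by
    rintro c p ⟨hp, hp'⟩
    constructor
    · intro φ h1 h2 h3
      rw [WithLp.smul_fst, WithLp.smul_snd, integral_inner_smul, integral_inner_smul,
        hp φ h1 h2 h3]
    · intro φ h1 h2
      rw [WithLp.smul_fst, WithLp.smul_snd, integral_inner_smul, integral_inner_smul, ← mul_sub,
        hp' φ h1 h2, mul_zero]

/-- The Hilbert space `V = H₀(curl; Ω)` with the graph norm. -/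
abbrev V (Ω : Set E3) : Type := ↥(H0curlSubmodule Ω)

/-- The dual space `U` of `V`, with the dual norm. -/
abbrev U (Ω : Set E3) : Type := V Ω →L[ℝ] ℝ

/-- The inclusion `V → L²(Ω)³`. -/
def field (Ω : Set E3) : V Ω →L[ℝ] L2 Ω :=
  (WithLp.fstL 2 ℝ (L2 Ω) (L2 Ω)).comp (H0curlSubmodule Ω).subtypeL

/-- The weak curl `∇ × : V → L²(Ω)³`. -/
def curl (Ω : Set E3) : V Ω →L[ℝ] L2 Ω :=
  (WithLp.sndL 2 ℝ (L2 Ω) (L2 Ω)).comp (H0curlSubmodule Ω).subtypeL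

/-- The embedding `V → U` through the pivot space `L²(Ω)³`: `B ↦ (A ↦ (B, A))`. -/
def pivot (Ω : Set E3) (B : V Ω) : U Ω :=
  (innerSL ℝ (field Ω B)).comp (field Ω)

/-- Lebesgue measure on the time interval `(0, T)`. -/
abbrev timeMeasure (T : ℝ) : Measure ℝ := volume.restrict (Ioo 0 T)

/-- `g'` is the weak (distributional) derivative on `(0, T)` of the Banach-space valued
function `g`. -/
def IsWeakTimeDeriv {X : Type*} [NormedAddCommGroup X] [NormedSpace ℝ X] (T : ℝ)
    (g g' : ℝ → X) : Prop :=
  ∀ φ : ℝ → ℝ, ContDiff ℝ ∞ φ → HasCompactSupport φ → tsupport φ ⊆ Ioo 0 T →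
    ∫ t in Ioo 0 T, deriv φ t • g t = - ∫ t in Ioo 0 T, φ t • g' t

/-- `g ∈ H¹(0, T; X)` (Bochner space). -/
def MemH1Time {X : Type*} [NormedAddCommGroup X] [NormedSpace ℝ X] (T : ℝ) (g : ℝ → X) : Prop :=
  MemLp g 2 (timeMeasure T) ∧
    ∃ g' : ℝ → X, MemLp g' 2 (timeMeasure T) ∧ IsWeakTimeDeriv T g g'

/-- `∇ · A = 0` in the sense of distributions on `Ω`. -/
def IsDivFree (Ω : Set E3) (A : L2 Ω) : Prop :=
  ∀ φ : E3 → ℝ, ContDiff ℝ ∞ φ → HasCompactSupport φ → tsupport φ ⊆ Ω →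
    ∫ x in Ω, inner ℝ (A x) (gradient φ x) = 0

/-- The open spherical shell `a < |x| < b`. -/
def shell (a b : ℝ) : Set E3 := {x | a < ‖x‖ ∧ ‖x‖ < b}

/-- The right-hand side paired with `A`:
`R_α (f / (1 + σ|B|²) B, ∇ × A) + R_m (u × B, ∇ × A)`, at a fixed time. -/
def source (Ω : Set E3) (Rα Rm σ : ℝ) (f : Lp ℝ ⊤ (volume.restrict Ω))
    (u : Lp E3 ⊤ (volume.restrict Ω)) (B A : V Ω) : ℝ :=
  Rα * (∫ x in Ω,
      inner ℝ ((f x / (1 + σ * ‖field Ω B x‖ ^ 2)) • field Ω B x) (curl Ω A x))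
    + Rm * ∫ x in Ω, inner ℝ (cross (u x) (field Ω B x)) (curl Ω A x)

/-- `B ∈ L²(0, T; V)` solves the weak formulation: it has a weak time derivative
`B' ∈ L²(0, T; U)`, satisfies the variational equation for a.e. `t` and all `A ∈ V`, and has a
representative in `C([0, T]; L²(Ω)³)` with value `B₀` at time `0`. -/
def IsWeakSolution (Ω : Set E3) (T : ℝ) (β : E3 → ℝ) (Rα Rm σ : ℝ)
    (f : ℝ → Lp ℝ ⊤ (volume.restrict Ω)) (u : ℝ → Lp E3 ⊤ (volume.restrict Ω))
    (B₀ : L2 Ω) (B : Lp (V Ω) 2 (timeMeasure T)) : Prop :=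
  (∃ B' : Lp (U Ω) 2 (timeMeasure T),
    IsWeakTimeDeriv T (fun t => pivot Ω (B t)) B' ∧
    ∀ᵐ t ∂(timeMeasure T), ∀ A : V Ω,
      B' t A + ∫ x in Ω, β x * inner ℝ (curl Ω (B t) x) (curl Ω A x)
        = source Ω Rα Rm σ (f t) (u t) (B t) A) ∧
  ∃ Bc : ℝ → L2 Ω, ContinuousOn Bc (Icc 0 T) ∧
    (∀ᵐ t ∂(timeMeasure T), Bc t = field Ω (B t)) ∧ Bc 0 = B₀

end Dynamo

end

/-!
The problem is read in the Hilbert space `V = H₀(curl; Ω)`, with the dual of `V` replaced by `V`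
through the Riesz isomorphism. If `j : V → L²(Ω)³` is the inclusion, the embedding of `V` into its
dual becomes `P = j^* j`, and the weak formulation becomes an evolution equation
`(P B)' + n(t) B = 0`, `B(0) = B₀`, where `n(t) v = ∇×^* (β ∇ × v - F(t, v))` and `F` is the
electromotive force. The map `y ↦ y / (1 + σ|y|²)` is globally Lipschitz and `f`, `u` are
essentially bounded in time and space (a function in `H¹(0, T; X)` is a.e. bounded), so `F(t, ·)`
is Lipschitz on `L²(Ω)³` uniformly in `t`. As `β ≥ β₀ > 0`, Young's inequality gives Gårding's
inequality `(n(t) v - n(t) w, v - w) ≥ (β₀ / 2) |v - w|² - l |j (v - w)|²`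
(`weakOperator_garding`).

*Existence* (`exists_solution_of_garding`). Replacing `B` by `e^{-lt} B` removes the term with `l`,
and the operator is continued to `t > T` by a multiple of the identity; what results is a Lipschitz
and strongly monotone operator `N` on `L²(0, ∞; V)`. The linear problem `P v' + κ v = h`,
`v(0) = B₀` is solved by Lions' projection method: the form `(v, φ) ↦ κ (v, φ) - (v, P φ')` is
coercive on test fields, because `-∫ (φ, P φ') = |j φ(0)|² / 2`
(`exists_linear_solution_operators`), and the solution operator `h ↦ v` has norm at most `κ⁻¹`. For
`κ = L² / m`, the map `κ - N` has Lipschitz constant less than `κ`, and Banach's fixed point theorem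
solves the nonlinear problem.

*Initial values* (`exists_continuous_representative`). For `U ∈ L²(ℝ; V)` with `(P U)' = G` in `L²`,
summing the increments of `|j U|²` over translates by `h` bounds the mean of `|j U|²` over any window
of length `h` by `2 |G| |U|`, uniformly in `h`. Hence every value of the continuous
representative of `P U` is of the form `j^* x` with `|x|² ≤ 2 |G| |U|`; the same bound for `U` minus
its translates gives continuity of `x` in `L²(Ω)³`. On the half-line the even reflection of the
solution is used.

*Uniqueness* (`ae_eq_zero_of_garding`). Letting `h → 0` in the window identity gives the energy
identity `|x(b)|² = 2 ∫_0^b (G, U)` for zero initial value. Applied to the difference of two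
solutions, Gårding's inequality and Gronwall's lemma show that the difference vanishes.

It remains to check that `V` is complete and dense in `L²(Ω)³`; the latter holds because smooth
fields with compact support in `Ω` belong to `V` (`exists_field_eq_test`).
-/

/-! ### Primitives and weak derivatives of vector-valued functions of time -/

section Primitives

open Filter Topology

variable {E : Type*} [NormedAddCommGroup E] [NormedSpace ℝ E]

/-- Integration by parts for the primitive of a real integrable function. -/
lemma integral_deriv_mul_primitive {θ : ℝ → ℝ} (hθ : ContDiff ℝ 1 θ) {R : ℝ}
    (hθR : θ R = 0) {g : ℝ → ℝ} (hg : IntervalIntegrable g volume 0 R) :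
    ∫ t in (0 : ℝ)..R, deriv θ t * (∫ s in (0 : ℝ)..t, g s)
      = - ∫ t in (0 : ℝ)..R, θ t * g t := by
  have h1 : AbsolutelyContinuousOnInterval θ 0 R := hθ.contDiffOn.absolutelyContinuousOnInterval
  have h2 : AbsolutelyContinuousOnInterval (fun t => ∫ s in (0 : ℝ)..t, g s) 0 R :=
    hg.absolutelyContinuousOnInterval_intervalIntegral (by simp)
  have h3 := h1.integral_mul_deriv_eq_deriv_mul h2
  have h4 : ∫ t in (0 : ℝ)..R, θ t * deriv (fun t => ∫ s in (0 : ℝ)..t, g s) t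
      = ∫ t in (0 : ℝ)..R, θ t * g t := by
    refine intervalIntegral.integral_congr_ae ?_
    filter_upwards [hg.ae_hasDerivAt_integral] with t ht hmem
    rw [(ht (uIoc_subset_uIcc hmem) 0 (by simp)).deriv]
  rw [h4] at h3
  simp only [hθR, intervalIntegral.integral_same] at h3
  linarith

/-- Integration by parts for the primitive of a Bochner integrable function, obtained from the
scalar case by testing with the continuous linear functionals. -/
lemma integral_deriv_smul_primitive [CompleteSpace E] {θ : ℝ → ℝ} (hθ : ContDiff ℝ 1 θ) {R : ℝ}
    (hθR : θ R = 0) {g : ℝ → E} (hg : IntervalIntegrable g volume 0 R) :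
    ∫ t in (0 : ℝ)..R, deriv θ t • (∫ s in (0 : ℝ)..t, g s)
      = - ∫ t in (0 : ℝ)..R, θ t • g t := by
  have hc : ContinuousOn (fun t => ∫ s in (0 : ℝ)..t, g s) (uIcc 0 R) :=
    intervalIntegral.continuousOn_primitive_interval' hg (by simp)
  have hd : Continuous (deriv θ) := hθ.continuous_deriv le_rfl
  have hi1 : IntervalIntegrable (fun t => deriv θ t • (∫ s in (0 : ℝ)..t, g s)) volume 0 R :=
    (hd.continuousOn.smul hc).intervalIntegrable
  have hi2 : IntervalIntegrable (fun t => θ t • g t) volume 0 R :=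
    hg.continuousOn_smul hθ.continuous.continuousOn
  refine (SeparatingDual.eq_iff_forall_dual_eq (R := ℝ)).2 fun L => ?_
  rw [map_neg, ← L.intervalIntegral_comp_comm hi1, ← L.intervalIntegral_comp_comm hi2]
  have hgL : IntervalIntegrable (fun t => L (g t)) volume 0 R :=
    ⟨L.integrable_comp hg.1, L.integrable_comp hg.2⟩
  have := integral_deriv_mul_primitive hθ hθR hgL
  simp only [map_smul, smul_eq_mul]
  rw [← this]
  refine intervalIntegral.integral_congr fun t ht => ?_
  rw [L.intervalIntegral_comp_comm (hg.mono_set (uIcc_subset_uIcc_left ht))]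

/-- The function `t ↦ ∫_0^t ψ` is smooth with derivative `ψ`. -/
lemma contDiff_primitive {ψ : ℝ → ℝ} (hψ : ContDiff ℝ ∞ ψ) :
    ContDiff ℝ ∞ (fun t => ∫ s in (0 : ℝ)..t, ψ s) ∧
      deriv (fun t => ∫ s in (0 : ℝ)..t, ψ s) = ψ := by
  have hd : ∀ t, HasDerivAt (fun t => ∫ s in (0 : ℝ)..t, ψ s) (ψ t) t := fun t =>
    intervalIntegral.integral_hasDerivAt_right (hψ.continuous.intervalIntegrable _ _)
      (hψ.continuous.stronglyMeasurableAtFilter _ _) hψ.continuous.continuousAt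
  have h2 : deriv (fun t => ∫ s in (0 : ℝ)..t, ψ s) = ψ := funext fun t => (hd t).deriv
  refine ⟨contDiff_infty_iff_deriv.2 ⟨fun t => (hd t).differentiableAt, ?_⟩, h2⟩
  rw [h2]; exact hψ

/-- The **du Bois-Reymond lemma**: an integrable function on `(0, T)` with vanishing weak derivative
is almost everywhere constant. -/
lemma exists_ae_eq_const_of_integral_deriv_smul_eq_zero [CompleteSpace E] {T : ℝ} (hT : 0 < T)
    {h : ℝ → E} (hh : IntegrableOn h (Ioo 0 T))
    (h0 : ∀ φ : ℝ → ℝ, ContDiff ℝ ∞ φ → HasCompactSupport φ → tsupport φ ⊆ Ioo 0 T →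
      ∫ t in Ioo 0 T, deriv φ t • h t = 0) :
    ∃ c : E, ∀ᵐ t ∂(volume.restrict (Ioo 0 T)), h t = c := by
  let b : ContDiffBump (T / 2) := ⟨T / 8, T / 4, by positivity, by linarith⟩
  have hbs : tsupport (b.normed volume) ⊆ Ioo 0 T := by
    rw [b.tsupport_normed_eq, Real.closedBall_eq_Icc]
    exact fun x hx => ⟨by have := hx.1; simp only [b] at this; linarith,
      by have := hx.2; simp only [b] at this; linarith⟩
  have hbc : ContDiff ℝ ∞ (b.normed volume) := b.contDiff_normed
  have hbk : HasCompactSupport (b.normed volume) := b.hasCompactSupport_normed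
  set c := ∫ t in Ioo 0 T, b.normed volume t • h t with hc
  refine ⟨c, ?_⟩
  have key : ∀ ψ : ℝ → ℝ, ContDiff ℝ ∞ ψ → HasCompactSupport ψ → tsupport ψ ⊆ Ioo 0 T →
      ∫ t, ψ t • (h t - c) ∂(volume.restrict (Ioo 0 T)) = 0 := by
    intro ψ hψ hψk hψs
    set I := ∫ t, ψ t with hI
    -- the mean-free part of `ψ` has a primitive that is again a test function
    set η : ℝ → ℝ := fun t => ψ t - I * b.normed volume t with hη
    have hηc : ContDiff ℝ ∞ η := hψ.sub (contDiff_const.mul hbc)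
    obtain ⟨hφ, hφd⟩ := contDiff_primitive hηc
    set φ : ℝ → ℝ := fun t => ∫ s in (0 : ℝ)..t, η s
    obtain ⟨K, hK, hKT, hKη⟩ : ∃ K : Set ℝ, IsCompact K ∧ K ⊆ Ioo 0 T ∧ ∀ t ∉ K, η t = 0 := by
      refine ⟨tsupport ψ ∪ tsupport (b.normed volume), hψk.isCompact.union hbk.isCompact,
        union_subset hψs hbs, fun t ht => ?_⟩
      simp only [hη]
      rw [image_eq_zero_of_notMem_tsupport fun h => ht (Or.inl h),
        image_eq_zero_of_notMem_tsupport fun h => ht (Or.inr h)]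
      simp
    have hηi : Integrable η := (hψ.continuous.integrable_of_hasCompactSupport hψk).sub
      ((hbc.continuous.integrable_of_hasCompactSupport hbk).const_mul I)
    have hη0 : ∫ t, η t = 0 := by
      simp only [hη]
      rw [integral_sub (hψ.continuous.integrable_of_hasCompactSupport hψk)
        ((hbc.continuous.integrable_of_hasCompactSupport hbk).const_mul I), integral_const_mul,
        b.integral_normed]
      simp [hI]
    obtain ⟨a', b', ha', hb', hK'⟩ : ∃ a' b' : ℝ, 0 < a' ∧ b' < T ∧ K ⊆ Icc a' b' := by
      rcases K.eq_empty_or_nonempty with rfl | hne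
      · exact ⟨1, T - 1, one_pos, by linarith, empty_subset _⟩
      · exact ⟨sInf K, sSup K, (hKT (hK.sInf_mem hne)).1, (hKT (hK.sSup_mem hne)).2,
          fun x hx => ⟨csInf_le hK.bddBelow hx, le_csSup hK.bddAbove hx⟩⟩
    have hφ0 : ∀ t ∉ Icc a' b', φ t = 0 := by
      intro t ht
      rw [mem_Icc, not_and_or, not_le, not_le] at ht
      rcases ht with ht | ht
      · have : ∀ s ∈ uIcc 0 t, η s = 0 := by
          intro s hs
          refine hKη s fun hsK => ?_
          have h1 := (hK' hsK).1
          rcases le_total 0 t with h | h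
          · rw [uIcc_of_le h] at hs; linarith [hs.2]
          · rw [uIcc_of_ge h] at hs; linarith [hs.2]
        simp only [φ]
        rw [intervalIntegral.integral_congr (g := fun _ => 0) this]; simp
      · by_cases h : 0 ≤ t
        · simp only [φ]
          rw [intervalIntegral.integral_of_le h]
          refine Eq.trans ?_ hη0
          refine setIntegral_eq_integral_of_forall_compl_eq_zero fun s hs => hKη s fun hsK => hs ?_
          exact ⟨(hKT hsK).1, by linarith [(hK' hsK).2]⟩
        · have : ∀ s ∈ uIcc 0 t, η s = 0 := by
            intro s hs
            refine hKη s fun hsK => ?_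
            have h1 := (hKT hsK).1
            rw [uIcc_of_ge (not_le.1 h).le] at hs; linarith [hs.2]
          simp only [φ]
          rw [intervalIntegral.integral_congr (g := fun _ => 0) this]; simp
    have hts : tsupport φ ⊆ Icc a' b' :=
      closure_minimal (fun t ht => by_contra fun h => ht (hφ0 t h)) isClosed_Icc
    have hφk : HasCompactSupport φ := HasCompactSupport.intro isCompact_Icc hφ0
    have h1 := h0 φ hφ hφk (hts.trans fun x hx => ⟨by linarith [hx.1], by linarith [hx.2]⟩)
    rw [hφd] at h1
    have hi : ∀ θ : ℝ → ℝ, Continuous θ → HasCompactSupport θ →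
        Integrable (fun t => θ t • h t) (volume.restrict (Ioo 0 T)) := by
      intro θ hθ hθk
      obtain ⟨C, hC⟩ := hθ.bounded_above_of_compact_support hθk
      exact Integrable.bdd_smul hh C hθ.aestronglyMeasurable (Eventually.of_forall hC)
    have h2 : ∫ t in Ioo 0 T, ψ t • h t = I • c := by
      have : ∀ t, η t • h t = ψ t • h t - I • (b.normed volume t • h t) := fun t => by
        simp only [hη, sub_smul, mul_smul]
      simp only [this] at h1
      have hbi : Integrable (fun t => I • b.normed volume t • h t) (volume.restrict (Ioo 0 T)) :=
        (hi _ hbc.continuous hbk).smul I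
      rw [integral_sub (hi ψ hψ.continuous hψk) hbi, integral_smul, sub_eq_zero] at h1
      exact h1
    have h3 : ∫ t in Ioo 0 T, ψ t = I := by
      refine setIntegral_eq_integral_of_forall_compl_eq_zero fun s hs => ?_
      exact image_eq_zero_of_notMem_tsupport fun h => hs (hψs h)
    have h4 : Integrable ψ (volume.restrict (Ioo 0 T)) :=
      (hψ.continuous.integrable_of_hasCompactSupport hψk).integrableOn
    simp only [smul_sub]
    rw [integral_sub (hi ψ hψ.continuous hψk) (h4.smul_const c), h2, integral_smul_const, h3,
      sub_self]
  have hli : LocallyIntegrableOn (fun t => h t - c) (Ioo 0 T) (volume.restrict (Ioo 0 T)) := by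
    refine IntegrableOn.locallyIntegrableOn ?_
    have : IsFiniteMeasure (volume.restrict (Ioo 0 T)) := ⟨by simp⟩
    exact (Integrable.sub hh (integrable_const c)).integrableOn
  have := isOpen_Ioo.ae_eq_zero_of_integral_contDiff_smul_eq_zero hli key
  filter_upwards [this, ae_restrict_mem measurableSet_Ioo] with t ht hm
  exact sub_eq_zero.1 (ht hm)

/-- A function with an integrable weak derivative on `(0, T)` is almost everywhere a primitive of
that derivative. -/
lemma Dynamo.IsWeakTimeDeriv.exists_ae_eq_primitive [CompleteSpace E] {T : ℝ} (hT : 0 < T)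
    {g g' : ℝ → E} (hg : IntegrableOn g (Ioo 0 T)) (hg' : IntegrableOn g' (Ioo 0 T))
    (h : Dynamo.IsWeakTimeDeriv T g g') :
    ∃ c : E, ∀ᵐ t ∂(volume.restrict (Ioo 0 T)), g t = c + ∫ s in (0 : ℝ)..t, g' s := by
  have hg'I : IntervalIntegrable g' volume 0 T :=
    (intervalIntegrable_iff_integrableOn_Ioo_of_le hT.le).2 hg'
  have hc : ContinuousOn (fun t => ∫ s in (0 : ℝ)..t, g' s) (Icc 0 T) := by
    have := intervalIntegral.continuousOn_primitive_interval' hg'I (a := 0) (by simp)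
    rwa [uIcc_of_le hT.le] at this
  have hci : IntegrableOn (fun t => ∫ s in (0 : ℝ)..t, g' s) (Ioo 0 T) :=
    (hc.integrableOn_Icc).mono_set Ioo_subset_Icc_self
  obtain ⟨c, hc'⟩ := exists_ae_eq_const_of_integral_deriv_smul_eq_zero hT
    (h := fun t => g t - ∫ s in (0 : ℝ)..t, g' s) (hg.sub hci) (by
      intro φ hφ hφk hφs
      have hφd : Continuous (deriv φ) := hφ.continuous_deriv (by simp)
      obtain ⟨C, hC⟩ := hφd.bounded_above_of_compact_support hφk.deriv
      have hi : ∀ f : ℝ → E, IntegrableOn f (Ioo 0 T) →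
          IntegrableOn (fun t => deriv φ t • f t) (Ioo 0 T) := fun f hf =>
        Integrable.bdd_smul hf C hφd.aestronglyMeasurable (Eventually.of_forall hC)
      simp only [smul_sub]
      rw [integral_sub (hi _ hg) (hi _ hci), h φ hφ hφk hφs]
      have hφT : φ T = 0 := image_eq_zero_of_notMem_tsupport fun h => lt_irrefl _ (hφs h).2
      have := integral_deriv_smul_primitive (hφ.of_le (by simp)) hφT hg'I
      rw [intervalIntegral.integral_of_le hT.le, intervalIntegral.integral_of_le hT.le,
        integral_Ioc_eq_integral_Ioo, integral_Ioc_eq_integral_Ioo] at this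
      rw [this, sub_self])
  refine ⟨c, ?_⟩
  filter_upwards [hc'] with t ht
  rw [← ht, sub_add_cancel]

/-- The embedding `H¹(0, T; X) ⊂ L^∞(0, T; X)`. -/
lemma Dynamo.MemH1Time.exists_ae_bound [CompleteSpace E] {T : ℝ} (hT : 0 < T) {g : ℝ → E}
    (h : Dynamo.MemH1Time T g) : ∃ C, ∀ᵐ t ∂(Dynamo.timeMeasure T), ‖g t‖ ≤ C := by
  have : IsFiniteMeasure (volume.restrict (Ioo 0 T)) := ⟨by simp⟩
  obtain ⟨h1, g', h2, h3⟩ := h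
  have hi' : IntegrableOn g' (Ioo 0 T) := h2.integrable (by norm_num)
  obtain ⟨c, hc⟩ := h3.exists_ae_eq_primitive hT (h1.integrable (by norm_num)) hi'
  refine ⟨‖c‖ + ∫ s in Ioo 0 T, ‖g' s‖, ?_⟩
  filter_upwards [hc, ae_restrict_mem measurableSet_Ioo] with t ht hm
  rw [ht]
  refine (norm_add_le _ _).trans ?_
  gcongr
  refine (intervalIntegral.norm_integral_le_integral_norm hm.1.le).trans ?_
  rw [intervalIntegral.integral_of_le hm.1.le, integral_Ioc_eq_integral_Ioo]
  exact setIntegral_mono_set hi'.norm (Eventually.of_forall fun _ => norm_nonneg _)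
    (Ioo_subset_Ioo_right hm.2.le).eventuallyLE

end Primitives

/-! ### Translations and Steklov averages in `L²(ℝ; E)` -/

section Steklov

open Filter Topology

variable {E : Type*} [NormedAddCommGroup E]

lemma MeasureTheory.MemLp.comp_add_right' {G : ℝ → E} (hG : MemLp G 2 volume) (s : ℝ) :
    MemLp (fun t => G (t + s)) 2 volume :=
  hG.comp_measurePreserving (measurePreserving_add_right volume s)

lemma eLpNorm_comp_add_right {G : ℝ → E} (hG : AEStronglyMeasurable G volume) (s : ℝ) :
    eLpNorm (fun t => G (t + s)) 2 volume = eLpNorm G 2 volume :=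
  eLpNorm_comp_measurePreserving hG (measurePreserving_add_right volume s)

/-- Continuity of translations in `L²(ℝ; E)`. -/
lemma tendsto_eLpNorm_translate_sub {G : ℝ → E} (hG : MemLp G 2 volume) :
    Tendsto (fun s : ℝ => eLpNorm (fun t => G (t + s) - G t) 2 volume) (𝓝 0) (𝓝 0) := by
  let g : C(ℝ, C(ℝ, ℝ)) := (ContinuousMap.mk (fun a : ℝ × ℝ => a.2 + a.1) (by fun_prop)).curry
  have hmp : ∀ s, MeasurePreserving (g s) volume volume := fun s =>
    measurePreserving_add_right volume s
  have h1 := (continuous_const (y := hG.toLp)).compMeasurePreservingLp g.continuous hmp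
    (p := 2) (by simp)
  have h2 := h1.tendsto 0
  rw [tendsto_iff_edist_tendsto_0] at h2
  refine h2.congr fun s => ?_
  have hcomp : ∀ s, Lp.compMeasurePreserving (g s) (hmp s) hG.toLp
      = (hG.comp_add_right' s).toLp := fun s => by
    rw [Lp.toLp_compMeasurePreserving]; rfl
  rw [hcomp, hcomp, Lp.edist_toLp_toLp]
  refine eLpNorm_congr_ae (Eventually.of_forall fun t => ?_)
  simp

lemma eLpNorm_two_sq_eq_lintegral {α : Type*} [MeasurableSpace α] {μ : Measure α} (f : α → E) :
    eLpNorm f 2 μ ^ 2 = ∫⁻ a, ‖f a‖ₑ ^ 2 ∂μ := by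
  have := eLpNorm_nnreal_pow_eq_lintegral (f := f) (μ := μ) (p := 2) (by norm_num)
  simpa only [NNReal.coe_ofNat, ENNReal.rpow_ofNat, ENNReal.coe_ofNat] using this

variable [NormedSpace ℝ E] [CompleteSpace E]

/-- The difference between the integral of `G` over a window of length `h` and `h c` times `G` is
controlled in `L²` by the largest `L²`-distance of `c G` to the translates occurring in the
window. -/
lemma eLpNorm_window_sub_le {G : ℝ → E} (hG : MemLp G 2 volume) (c : ℝ) {h : ℝ} (hh : 0 < h)
    {M : ℝ≥0∞} (hM : ∀ s ∈ Ioo 0 h, eLpNorm (fun t => G (t + s) - c • G t) 2 volume ≤ M) :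
    eLpNorm (fun t => (∫ s in Ioo 0 h, G (t + s)) - (h * c) • G t) 2 volume
      ≤ ENNReal.ofReal h * M := by
  set D : ℝ → ℝ → E := fun t s => G (t + s) - c • G t with hD
  have hfin : IsFiniteMeasure (volume.restrict (Ioo 0 h)) := ⟨by simp⟩
  have hDm : AEStronglyMeasurable (fun p : ℝ × ℝ => D p.1 p.2)
      ((volume : Measure ℝ).prod (volume.restrict (Ioo 0 h))) := by
    have h1 : AEStronglyMeasurable (fun p : ℝ × ℝ => G (p.1 + p.2))
        ((volume : Measure ℝ).prod volume) := by
      have hq : Measure.QuasiMeasurePreserving (fun p : ℝ × ℝ => p.1 + p.2)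
          ((volume : Measure ℝ).prod volume) volume :=
        Measure.quasiMeasurePreserving_snd.comp
          (measurePreserving_prod_add (volume : Measure ℝ) volume).quasiMeasurePreserving
      exact hG.1.comp_quasiMeasurePreserving hq
    have h2 : AEStronglyMeasurable (fun p : ℝ × ℝ => G (p.1 + p.2))
        ((volume : Measure ℝ).prod (volume.restrict (Ioo 0 h))) :=
      h1.mono_ac (Measure.AbsolutelyContinuous.rfl.prod Measure.restrict_le_self.absolutelyContinuous)
    exact h2.sub (hG.1.comp_fst.const_smul c)
  have hint : ∀ t, ‖(∫ s in Ioo 0 h, G (t + s)) - (h * c) • G t‖ₑ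
      ≤ ∫⁻ s in Ioo 0 h, ‖D t s‖ₑ := by
    intro t
    have hi : Integrable (fun s => G (t + s)) (volume.restrict (Ioo 0 h)) := by
      have := (hG.comp_measurePreserving (measurePreserving_add_left volume t))
      exact (this.restrict (Ioo 0 h)).integrable (by norm_num)
    have : (∫ s in Ioo 0 h, G (t + s)) - (h * c) • G t = ∫ s in Ioo 0 h, D t s := by
      rw [hD]
      simp only
      rw [integral_sub hi (integrable_const _)]
      simp [mul_smul, hh.le, Measure.real]
    rw [this]
    exact enorm_integral_le_lintegral_enorm _
  have hDt : ∀ᵐ t, AEStronglyMeasurable (D t) (volume.restrict (Ioo 0 h)) := hDm.prodMk_left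
  have hcs : ∀ᵐ t, (∫⁻ s in Ioo 0 h, ‖D t s‖ₑ) ^ 2
      ≤ ENNReal.ofReal h * ∫⁻ s in Ioo 0 h, ‖D t s‖ₑ ^ 2 := by
    filter_upwards [hDt] with t ht
    have h1 := eLpNorm_le_eLpNorm_mul_rpow_measure_univ (p := 1) (q := 2) (by norm_num) ht
    rw [eLpNorm_one_eq_lintegral_enorm] at h1
    calc _ ≤ (eLpNorm (D t) 2 (volume.restrict (Ioo 0 h))
          * (volume.restrict (Ioo 0 h)) univ ^
            (1 / (1 : ℝ≥0∞).toReal - 1 / (2 : ℝ≥0∞).toReal)) ^ 2 := by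
          gcongr
      _ = ENNReal.ofReal h * eLpNorm (D t) 2 (volume.restrict (Ioo 0 h)) ^ 2 := by
          rw [mul_pow, ← ENNReal.rpow_natCast (_ ^ (_ : ℝ)), ← ENNReal.rpow_mul, mul_comm]
          norm_num
      _ = _ := by
          rw [eLpNorm_two_sq_eq_lintegral]
  have h2 : eLpNorm (fun t => (∫ s in Ioo 0 h, G (t + s)) - (h * c) • G t) 2 volume ^ 2
      ≤ (ENNReal.ofReal h * M) ^ 2 := by
    rw [eLpNorm_two_sq_eq_lintegral]
    calc _ ≤ ∫⁻ t, ENNReal.ofReal h * ∫⁻ s in Ioo 0 h, ‖D t s‖ₑ ^ 2 := by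
          refine lintegral_mono_ae ?_
          filter_upwards [hcs] with t ht
          refine le_trans ?_ ht
          gcongr
          exact hint t
      _ = ENNReal.ofReal h * ∫⁻ t, ∫⁻ s in Ioo 0 h, ‖D t s‖ₑ ^ 2 :=
          lintegral_const_mul' _ _ ENNReal.ofReal_ne_top
      _ = ENNReal.ofReal h * ∫⁻ s in Ioo 0 h, ∫⁻ t, ‖D t s‖ₑ ^ 2 := by
          rw [lintegral_lintegral_swap]
          exact hDm.enorm.pow_const 2
      _ ≤ ENNReal.ofReal h * ∫⁻ s in Ioo 0 h, M ^ 2 := by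
          gcongr ENNReal.ofReal h * ?_
          refine setLIntegral_mono measurable_const fun s hs => ?_
          rw [← eLpNorm_two_sq_eq_lintegral]
          gcongr
          exact hM s hs
      _ = _ := by
          rw [setLIntegral_const, Real.volume_Ioo, sub_zero]; ring
  exact (ENNReal.pow_le_pow_left_iff two_ne_zero).1 h2

end Steklov

/-! ### The energy identity -/

section Window

open Filter Topology

variable {E : Type*} [NormedAddCommGroup E]

lemma MeasureTheory.MemLp.intervalIntegrable_two {G : ℝ → E} (hG : MemLp G 2 volume) (a b : ℝ) :
    IntervalIntegrable G volume a b := by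
  constructor
  · have : IsFiniteMeasure (volume.restrict (Ioc a b)) := ⟨by simp⟩
    exact (hG.restrict _).integrable (by norm_num)
  · have : IsFiniteMeasure (volume.restrict (Ioc b a)) := ⟨by simp⟩
    exact (hG.restrict _).integrable (by norm_num)

lemma lpNorm_comp_add_right {G : ℝ → E} (hG : MemLp G 2 volume) (s : ℝ) :
    lpNorm (fun t => G (t + s)) 2 volume = lpNorm G 2 volume := by
  rw [← toReal_eLpNorm (hG.comp_add_right' s).1, ← toReal_eLpNorm hG.1,
    eLpNorm_comp_add_right hG.1]

lemma tendsto_lpNorm_translate_sub {G : ℝ → E} (hG : MemLp G 2 volume) :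
    Tendsto (fun s : ℝ => lpNorm (fun t => G (t + s) - G t) 2 volume) (𝓝 0) (𝓝 0) := by
  have := (ENNReal.tendsto_toReal ENNReal.zero_ne_top).comp (tendsto_eLpNorm_translate_sub hG)
  refine this.congr fun s => ?_
  exact toReal_eLpNorm ((hG.comp_add_right' s).sub hG).1

variable [NormedSpace ℝ E]

lemma setIntegral_window_eq (G : ℝ → E) (t : ℝ) {h : ℝ} (hh : 0 < h) :
    ∫ s in Ioo 0 h, G (t + s) = ∫ s in t..(t + h), G s := by
  rw [← integral_Ioc_eq_integral_Ioo, ← intervalIntegral.integral_of_le hh.le,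
    intervalIntegral.integral_comp_add_left (fun x => G x)]
  simp

variable [CompleteSpace E]

/-- Integration over a window of length `h` has norm at most `h` on `L²(ℝ; E)`. -/
lemma memLp_window {G : ℝ → E} (hG : MemLp G 2 volume) {h : ℝ} (hh : 0 < h) :
    MemLp (fun t => ∫ s in t..(t + h), G s) 2 volume ∧
      lpNorm (fun t => ∫ s in t..(t + h), G s) 2 volume ≤ h * lpNorm G 2 volume := by
  have hc : Continuous fun t => ∫ s in t..(t + h), G s := by
    have h1 := intervalIntegral.continuous_primitive hG.intervalIntegrable_two 0
    have h2 : (fun t => ∫ s in t..(t + h), G s)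
        = fun t => (∫ s in (0 : ℝ)..(t + h), G s) - ∫ s in (0 : ℝ)..t, G s := by
      funext t
      rw [intervalIntegral.integral_interval_sub_left] <;> exact hG.intervalIntegrable_two _ _
    rw [h2]
    exact (h1.comp (continuous_id.add continuous_const)).sub h1
  have h1 := eLpNorm_window_sub_le hG 0 hh (M := eLpNorm G 2 volume) fun s _ => by
    simp only [zero_smul, sub_zero]; exact (eLpNorm_comp_add_right hG.1 s).le
  simp only [mul_zero, zero_smul, sub_zero, setIntegral_window_eq G _ hh] at h1
  have hm : MemLp (fun t => ∫ s in t..(t + h), G s) 2 volume :=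
    ⟨hc.aestronglyMeasurable, h1.trans_lt (ENNReal.mul_lt_top (by simp) hG.2)⟩
  refine ⟨hm, ?_⟩
  rw [← toReal_eLpNorm hm.1, ← toReal_eLpNorm hG.1]
  have := ENNReal.toReal_mono (ENNReal.mul_ne_top (by simp) hG.2.ne) h1
  rwa [ENNReal.toReal_mul, ENNReal.toReal_ofReal hh.le] at this

/-- Steklov averages converge in `L²(ℝ; E)`. -/
lemma tendsto_steklov {G : ℝ → E} (hG : MemLp G 2 volume) :
    Tendsto (fun h : ℝ => lpNorm (fun t => h⁻¹ • (∫ s in t..(t + h), G s) - G t) 2 volume)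
      (𝓝[>] 0) (𝓝 0) := by
  refine Metric.tendsto_nhds.2 fun ε hε => ?_
  have h1 := tendsto_eLpNorm_translate_sub hG
  have h2 := h1.eventually (gt_mem_nhds (show (0 : ℝ≥0∞) < ENNReal.ofReal (ε / 2) by simpa))
  obtain ⟨δ, hδ, h3⟩ := Metric.eventually_nhds_iff.1 h2
  filter_upwards [Ioo_mem_nhdsGT hδ] with h hh
  have hhp : 0 < h := hh.1
  have h4 := eLpNorm_window_sub_le hG 1 hh.1 (M := ENNReal.ofReal (ε / 2)) fun s hs => by
    simp only [one_smul]
    refine (h3 ?_).le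
    rw [Real.dist_eq, sub_zero, abs_of_pos hs.1]; exact hs.2.trans hh.2
  simp only [mul_one, setIntegral_window_eq G _ hhp] at h4
  have h5 : MemLp (fun t => h⁻¹ • (∫ s in t..(t + h), G s) - G t) 2 volume :=
    ((memLp_window hG hhp).1.const_smul h⁻¹).sub hG
  have h6 : (fun t => (∫ s in t..(t + h), G s) - h • G t)
      = h • fun t => h⁻¹ • (∫ s in t..(t + h), G s) - G t := by
    funext t
    simp only [Pi.smul_apply, smul_sub, smul_smul, mul_inv_cancel₀ hhp.ne', one_smul]
  have h7 := ENNReal.toReal_mono (by finiteness) h4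
  rw [h6, toReal_eLpNorm (h5.const_smul h).1, lpNorm_const_smul, coe_nnnorm, ← ENNReal.ofReal_mul hhp.le,
    ENNReal.toReal_ofReal (by positivity), Real.norm_of_nonneg hhp.le] at h7
  rw [Real.dist_eq, sub_zero, abs_of_nonneg lpNorm_nonneg]
  have := le_of_mul_le_mul_left h7 hhp
  linarith

end Window

section Energy

open Filter Topology

variable {V H : Type*} [NormedAddCommGroup V] [InnerProductSpace ℝ V]

lemma MeasureTheory.MemLp.integrable_inner' {α : Type*} [MeasurableSpace α] {μ : Measure α}
    {F Z : α → V} (hF : MemLp F 2 μ) (hZ : MemLp Z 2 μ) :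
    Integrable (fun x => inner ℝ (F x) (Z x)) μ := by
  refine (L2.integrable_inner (𝕜 := ℝ) hF.toLp hZ.toLp).congr ?_
  filter_upwards [hF.coeFn_toLp, hZ.coeFn_toLp] with x h1 h2
  rw [h1, h2]

lemma MeasureTheory.MemLp.inner_toLp_eq {α : Type*} [MeasurableSpace α] {μ : Measure α}
    {F Z : α → V} (hF : MemLp F 2 μ) (hZ : MemLp Z 2 μ) :
    inner ℝ hF.toLp hZ.toLp = ∫ x, inner ℝ (F x) (Z x) ∂μ := by
  rw [L2.inner_def]
  refine integral_congr_ae ?_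
  filter_upwards [hF.coeFn_toLp, hZ.coeFn_toLp] with x h1 h2
  rw [h1, h2]

/-- The Cauchy-Schwarz inequality in `L²(ℝ; V)`, on a subset. -/
lemma abs_setIntegral_inner_le {F Z : ℝ → V} (hF : MemLp F 2 volume) (hZ : MemLp Z 2 volume)
    (S : Set ℝ) :
    |∫ x in S, inner ℝ (F x) (Z x)| ≤ lpNorm F 2 volume * lpNorm Z 2 volume := by
  have h1 : ∀ {Y : ℝ → V} (hY : MemLp Y 2 volume),
      ‖(hY.restrict S).toLp‖ ≤ lpNorm Y 2 volume := fun {Y} hY => by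
    rw [Lp.norm_toLp, ← toReal_eLpNorm hY.1]
    exact ENNReal.toReal_mono hY.2.ne (eLpNorm_mono_measure _ Measure.restrict_le_self)
  rw [← (hF.restrict S).inner_toLp_eq (hZ.restrict S)]
  refine (abs_real_inner_le_norm _ _).trans ?_
  gcongr
  · exact lpNorm_nonneg
  · exact h1 hF
  · exact h1 hZ

variable [CompleteSpace V] [NormedAddCommGroup H] [InnerProductSpace ℝ H] [CompleteSpace H]

/-- The operator `j* j` on `V`; under the Riesz identification of `V` with its dual it is the
embedding of `V` into its dual through the pivot space `H`. -/
noncomputable def pivotOp (j : V →L[ℝ] H) : V →L[ℝ] V := (ContinuousLinearMap.adjoint j).comp j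

@[simp] lemma inner_pivotOp_left (j : V →L[ℝ] H) (x y : V) :
    inner ℝ (pivotOp j x) y = inner ℝ (j x) (j y) := by
  simp [pivotOp, ContinuousLinearMap.adjoint_inner_left]

lemma norm_sq_sub_norm_sq_eq (j : V →L[ℝ] H) (x y : V) :
    ‖j x‖ ^ 2 - ‖j y‖ ^ 2 = inner ℝ (pivotOp j x - pivotOp j y) (x + y) := by
  rw [← map_sub, inner_pivotOp_left, map_sub, map_add, ← real_inner_self_eq_norm_sq,
    ← real_inner_self_eq_norm_sq, inner_sub_left, inner_add_right, inner_add_right,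
    real_inner_comm (j y) (j x)]
  ring

/-- The energy balance over a window: the increments of `|U|²` are expressed through the increments
of `w`, without differentiating. -/
lemma integral_window_norm_sq (j : V →L[ℝ] H) {U G w : ℝ → V} (hU : MemLp U 2 volume)
    (hw : ∀ s t, w t - w s = ∫ x in s..t, G x) {b h : ℝ} (hh : 0 < h)
    (hUw : ∀ᵐ t, t < b + h → pivotOp j (U t) = w t) :
    ∫ t in Ioo b (b + h), ‖j (U t)‖ ^ 2
      = ∫ t in Iio b, inner ℝ (∫ s in t..(t + h), G s) (U (t + h) + U t) := by
  have hjU : MemLp (fun t => j (U t)) 2 volume := j.comp_memLp' hU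
  have hi : Integrable (fun t => ‖j (U t)‖ ^ 2) := hjU.norm.integrable_sq
  have hi' : Integrable (fun t => ‖j (U (t + h))‖ ^ 2) := hi.comp_add_right h
  have h1 : ∫ t in Iio b, ‖j (U (t + h))‖ ^ 2 = ∫ t in Iio (b + h), ‖j (U t)‖ ^ 2 := by
    have := (measurePreserving_add_right volume h).setIntegral_preimage_emb
      (measurableEmbedding_addRight h) (fun t => ‖j (U t)‖ ^ 2) (Iio (b + h))
    rw [← this]
    congr 2
    ext t; simp
  have h2 : ∫ t in Iio (b + h), ‖j (U t)‖ ^ 2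
      = (∫ t in Iio b, ‖j (U t)‖ ^ 2) + ∫ t in Ioo b (b + h), ‖j (U t)‖ ^ 2 := by
    rw [← Iio_union_Ico_eq_Iio (show b ≤ b + h by linarith), setIntegral_union
      (by rw [Set.disjoint_left]; intro x hx hx'; exact absurd hx'.1 (not_le.2 hx))
      measurableSet_Ico hi.integrableOn hi.integrableOn, integral_Ico_eq_integral_Ioo]
  have h3 : ∫ t in Ioo b (b + h), ‖j (U t)‖ ^ 2
      = ∫ t in Iio b, (‖j (U (t + h))‖ ^ 2 - ‖j (U t)‖ ^ 2) := by
    rw [integral_sub hi'.integrableOn hi.integrableOn, h1, h2]; ring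
  rw [h3]
  have hUw' : ∀ᵐ t, t + h < b + h → pivotOp j (U (t + h)) = w (t + h) :=
    (measurePreserving_add_right volume h).quasiMeasurePreserving.ae hUw
  refine setIntegral_congr_ae measurableSet_Iio ?_
  filter_upwards [hUw, hUw'] with t ht ht' htb
  rw [norm_sq_sub_norm_sq_eq, ht (by linarith [mem_Iio.1 htb]),
    ht' (by linarith [mem_Iio.1 htb]), hw]

lemma integral_window_norm_sq_le (j : V →L[ℝ] H) {U G w : ℝ → V} (hU : MemLp U 2 volume)
    (hG : MemLp G 2 volume) (hw : ∀ s t, w t - w s = ∫ x in s..t, G x) {b h : ℝ} (hh : 0 < h)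
    (hUw : ∀ᵐ t, t < b + h → pivotOp j (U t) = w t) :
    ∫ t in Ioo b (b + h), ‖j (U t)‖ ^ 2 ≤ h * (2 * lpNorm G 2 volume * lpNorm U 2 volume) := by
  rw [integral_window_norm_sq j hU hw hh hUw]
  obtain ⟨h1, h2⟩ := memLp_window hG hh
  have h3 : MemLp (fun t => U (t + h) + U t) 2 volume := (hU.comp_add_right' h).add hU
  have h4 : lpNorm (fun t => U (t + h) + U t) 2 volume ≤ 2 * lpNorm U 2 volume := by
    refine (lpNorm_add_le (hU.comp_add_right' h) (by norm_num)).trans ?_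
    rw [lpNorm_comp_add_right hU]; linarith
  calc _ ≤ _ := le_abs_self _
    _ ≤ _ := abs_setIntegral_inner_le h1 h3 (Iio b)
    _ ≤ (h * lpNorm G 2 volume) * (2 * lpNorm U 2 volume) := by
        gcongr
        · exact lpNorm_nonneg
        · exact mul_nonneg hh.le lpNorm_nonneg
    _ = _ := by ring

/-- The energy identity: the averages of `|U|²` over shrinking windows to the right of `b` converge
to twice the work done before `b`. -/
lemma tendsto_average_norm_sq (j : V →L[ℝ] H) {U G w : ℝ → V} (hU : MemLp U 2 volume)
    (hG : MemLp G 2 volume) (hw : ∀ s t, w t - w s = ∫ x in s..t, G x) {b T : ℝ} (hb : b < T)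
    (hUw : ∀ᵐ t, t < T → pivotOp j (U t) = w t) :
    Tendsto (fun h : ℝ => h⁻¹ * ∫ t in Ioo b (b + h), ‖j (U t)‖ ^ 2) (𝓝[>] 0)
      (𝓝 (2 * ∫ t in Iio b, inner ℝ (G t) (U t))) := by
  have key : ∀ᶠ h : ℝ in 𝓝[>] 0,
      ‖h⁻¹ * (∫ t in Ioo b (b + h), ‖j (U t)‖ ^ 2) - 2 * ∫ t in Iio b, inner ℝ (G t) (U t)‖
        ≤ lpNorm (fun t => h⁻¹ • (∫ s in t..(t + h), G s) - G t) 2 volume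
            * (2 * lpNorm U 2 volume)
          + lpNorm G 2 volume * lpNorm (fun t => U (t + h) - U t) 2 volume := by
    filter_upwards [Ioo_mem_nhdsGT (sub_pos.2 hb)] with h hh
    have hhp : 0 < h := hh.1
    have hhT : b + h < T := by linarith [hh.2]
    rw [integral_window_norm_sq j hU hw hh.1 (by
      filter_upwards [hUw] with t ht htb using ht (htb.trans hhT))]
    obtain ⟨h1, h2⟩ := memLp_window hG hhp
    set W := fun t => ∫ s in t..(t + h), G s
    have hZ : MemLp (fun t => U (t + h) + U t) 2 volume := (hU.comp_add_right' h).add hU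
    have hZ' : MemLp (fun t => U (t + h) - U t) 2 volume := (hU.comp_add_right' h).sub hU
    have hD : MemLp (fun t => h⁻¹ • W t - G t) 2 volume := (h1.const_smul h⁻¹).sub hG
    have h4 : lpNorm (fun t => U (t + h) + U t) 2 volume ≤ 2 * lpNorm U 2 volume := by
      refine (lpNorm_add_le (hU.comp_add_right' h) (by norm_num)).trans ?_
      rw [lpNorm_comp_add_right hU]; linarith
    have h5 : h⁻¹ * (∫ t in Iio b, inner ℝ (W t) (U (t + h) + U t))
          - 2 * ∫ t in Iio b, inner ℝ (G t) (U t)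
        = (∫ t in Iio b, inner ℝ (h⁻¹ • W t - G t) (U (t + h) + U t))
          + ∫ t in Iio b, inner ℝ (G t) (U (t + h) - U t) := by
      rw [← integral_const_mul, ← integral_const_mul, ← integral_sub
        (((h1.integrable_inner' hZ).const_mul _).integrableOn)
        (((hG.integrable_inner' hU).const_mul _).integrableOn), ← integral_add
        (hD.integrable_inner' hZ).integrableOn (hG.integrable_inner' hZ').integrableOn]
      refine integral_congr_ae (Eventually.of_forall fun t => ?_)
      simp only [inner_sub_left, inner_add_right, inner_sub_right, real_inner_smul_left]
      ring
    rw [h5]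
    refine (norm_add_le _ _).trans (add_le_add ?_ ?_)
    · refine (abs_setIntegral_inner_le hD hZ _).trans ?_
      gcongr
      exact lpNorm_nonneg
    · exact abs_setIntegral_inner_le hG hZ' _
  rw [tendsto_iff_norm_sub_tendsto_zero]
  refine squeeze_zero' (Eventually.of_forall fun _ => norm_nonneg _) key ?_
  have h1 := (tendsto_steklov hG).mul_const (2 * lpNorm U 2 volume)
  have h2 := ((tendsto_lpNorm_translate_sub hU).mono_left nhdsWithin_le_nhds).const_mul
    (b := lpNorm G 2 volume) (x := 𝓝[>] (0 : ℝ))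
  simpa using h1.add h2

end Energy

/-! ### Continuous representatives with values in the pivot space -/

section Representative

open Filter Topology

variable {V H : Type*} [NormedAddCommGroup V] [InnerProductSpace ℝ V]

lemma continuous_of_forall_sub_eq_integral {G w : ℝ → V} (hG : MemLp G 2 volume)
    (hw : ∀ s t, w t - w s = ∫ x in s..t, G x) : Continuous w := by
  have h1 := intervalIntegral.continuous_primitive hG.intervalIntegrable_two 0
  have h2 : w = fun t => w 0 + ∫ x in (0 : ℝ)..t, G x := by
    funext t; rw [← hw]; abel
  rw [h2]
  exact continuous_const.add h1

variable [NormedAddCommGroup H] [InnerProductSpace ℝ H] {j : V →L[ℝ] H}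

lemma norm_le_of_abs_inner_denseRange_le (hj : DenseRange j) {y : H} {M : ℝ} (hM : 0 ≤ M)
    (h : ∀ A, |inner ℝ y (j A)| ≤ M * ‖j A‖) : ‖y‖ ≤ M := by
  have h1 : |inner ℝ y y| ≤ M * ‖y‖ :=
    isClosed_property hj (p := fun z => |inner ℝ y z| ≤ M * ‖z‖)
      (isClosed_le (by fun_prop) (by fun_prop)) h y
  rw [real_inner_self_eq_norm_sq, abs_of_nonneg (by positivity), sq] at h1
  rcases (norm_nonneg y).eq_or_lt with h0 | h0
  · rwa [← h0]
  · exact le_of_mul_le_mul_right h1 h0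

lemma eq_of_forall_inner_denseRange_eq (hj : DenseRange j) {y z : H}
    (h : ∀ A, inner ℝ y (j A) = inner ℝ z (j A)) : y = z := by
  have := norm_le_of_abs_inner_denseRange_le hj (y := y - z) le_rfl fun A => by
    rw [inner_sub_left, h, sub_self, abs_zero, zero_mul]
  exact sub_eq_zero.1 (norm_le_zero_iff.1 this)

variable [CompleteSpace H]

/-- A vector of `V` whose pairing with `A` is controlled by `|j A|` comes from a vector of `H`. -/
lemma exists_inner_eq_of_abs_inner_le (hj : DenseRange j) {w : V} {M : ℝ}
    (h : ∀ A, |inner ℝ w A| ≤ M * ‖j A‖) : ∃ x : H, ∀ A, inner ℝ x (j A) = inner ℝ w A := by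
  set f : V →ₗ[ℝ] ℝ := (innerSL ℝ w).toLinearMap
  have hf : ∀ A, f.extendOfNorm j.toLinearMap (j A) = inner ℝ w A := fun A =>
    LinearMap.extendOfNorm_eq (f := f) (e := j.toLinearMap) hj ⟨M, h⟩ A
  refine ⟨(InnerProductSpace.toDual ℝ H).symm (f.extendOfNorm j.toLinearMap), fun A => ?_⟩
  rw [InnerProductSpace.toDual_symm_apply, hf]

variable [CompleteSpace V]

/-- The trace estimate: although `w` is only given with values in the dual of `V`, its values are
bounded in the norm of `H`. -/
lemma abs_inner_le_of_pivotOp_ae_eq {U G w : ℝ → V} (hU : MemLp U 2 volume)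
    (hG : MemLp G 2 volume) (hw : ∀ s t, w t - w s = ∫ x in s..t, G x)
    (hUw : ∀ᵐ t, pivotOp j (U t) = w t) (b : ℝ) (A : V) :
    |inner ℝ (w b) A| ≤ √(2 * lpNorm G 2 volume * lpNorm U 2 volume) * ‖j A‖ := by
  set C := 2 * lpNorm G 2 volume * lpNorm U 2 volume with hC
  have hc : Continuous w := continuous_of_forall_sub_eq_integral hG hw
  have ht : Tendsto (fun t => |inner ℝ (w t) A|) (𝓝[>] b) (𝓝 |inner ℝ (w b) A|) :=
    ((hc.inner continuous_const).abs.tendsto b).mono_left nhdsWithin_le_nhds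
  refine le_of_tendsto_of_frequently ht ?_
  rw [(nhdsGT_basis b).frequently_iff]
  intro c hbc
  have hpos : 0 < c - b := sub_pos.2 hbc
  have hle := integral_window_norm_sq_le j hU hG hw hpos (b := b)
    (by filter_upwards [hUw] with t ht _ using ht)
  rw [add_sub_cancel] at hle
  have hi : Integrable (fun t => ‖j (U t)‖ ^ 2) (volume.restrict (Ioo b c)) :=
    ((j.comp_memLp' hU).norm.integrable_sq).integrableOn
  have hne : volume.restrict (Ioo b c) ≠ 0 := by
    rw [Ne, Measure.restrict_eq_zero]; simp [hbc]
  have hfin : IsFiniteMeasure (volume.restrict (Ioo b c)) := ⟨by simp⟩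
  have hN : volume.restrict (Ioo b c) {t | ¬(t ∈ Ioo b c ∧ pivotOp j (U t) = w t)} = 0 :=
    (ae_restrict_mem measurableSet_Ioo).and (ae_restrict_of_ae hUw)
  obtain ⟨t, htN, htle⟩ := exists_notMem_null_le_average hne hi hN
  obtain ⟨htm, htw⟩ := not_not.1 htN
  refine ⟨t, htm, ?_⟩
  have h1 : ‖j (U t)‖ ^ 2 ≤ C := by
    refine htle.trans ?_
    rw [average_eq, smul_eq_mul, measureReal_restrict_apply_univ, Real.volume_real_Ioo_of_le hbc.le,
      inv_mul_le_iff₀ hpos]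
    exact hle
  rw [← htw, inner_pivotOp_left]
  refine (abs_real_inner_le_norm _ _).trans ?_
  gcongr
  exact Real.le_sqrt_of_sq_le h1

/-- If `U ∈ L²(ℝ; V)` has its weak derivative in `L²` of the dual, then it has a continuous
representative in `H`. The trace estimate, applied to the difference of `U` and a translate of `U`,
turns continuity of translations in `L²` into continuity in `H`. -/
theorem exists_continuous_representative (hj : DenseRange j) {U G w : ℝ → V}
    (hU : MemLp U 2 volume) (hG : MemLp G 2 volume) (hw : ∀ s t, w t - w s = ∫ x in s..t, G x)
    (hUw : ∀ᵐ t, pivotOp j (U t) = w t) :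
    ∃ x : ℝ → H, Continuous x ∧ ∀ b A, inner ℝ (x b) (j A) = inner ℝ (w b) A := by
  choose x hx using fun b => exists_inner_eq_of_abs_inner_le hj
    (abs_inner_le_of_pivotOp_ae_eq hU hG hw hUw b)
  refine ⟨x, continuous_iff_continuousAt.2 fun b => ?_, hx⟩
  have hle : ∀ s, ‖x (b + s) - x b‖ ≤ √(2 * lpNorm (fun t => G (t + s) - G t) 2 volume
      * lpNorm (fun t => U (t + s) - U t) 2 volume) := by
    intro s
    refine norm_le_of_abs_inner_denseRange_le hj (Real.sqrt_nonneg _) fun A => ?_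
    rw [inner_sub_left, hx, hx, ← inner_sub_left]
    refine abs_inner_le_of_pivotOp_ae_eq (w := fun t => w (t + s) - w t)
      ((hU.comp_add_right' s).sub hU) ((hG.comp_add_right' s).sub hG) ?_ ?_ b A
    · intro a c
      simp only [Pi.sub_apply]
      rw [intervalIntegral.integral_sub ((hG.comp_add_right' s).intervalIntegrable_two _ _)
        (hG.intervalIntegrable_two _ _), intervalIntegral.integral_comp_add_right (fun x => G x),
        ← hw, ← hw]
      abel
    · have hUw' : ∀ᵐ t, pivotOp j (U (t + s)) = w (t + s) :=
        (measurePreserving_add_right volume s).quasiMeasurePreserving.ae hUw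
      filter_upwards [hUw, hUw'] with t h1 h2
      rw [Pi.sub_apply, map_sub, h1, h2]
  have h0 : Tendsto (fun s => √(2 * lpNorm (fun t => G (t + s) - G t) 2 volume
      * lpNorm (fun t => U (t + s) - U t) 2 volume)) (𝓝 0) (𝓝 0) := by
    have := (((tendsto_lpNorm_translate_sub hG).const_mul 2).mul
      (tendsto_lpNorm_translate_sub hU)).sqrt
    simpa using this
  have h1 : Tendsto (fun s => x (b + s) - x b) (𝓝 0) (𝓝 0) :=
    squeeze_zero_norm hle h0
  have h2 : Tendsto (fun t => t - b) (𝓝 b) (𝓝 0) := by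
    have : Continuous fun t : ℝ => t - b := by fun_prop
    simpa using this.tendsto b
  have h3 := (h1.comp h2).add_const (x b)
  simpa [ContinuousAt, Function.comp_def] using h3

end Representative

/-! ### Lions' projection theorem for evolution problems on the half-line -/

section Lions

open Filter Topology

/-- A linear map `f` that is bounded relative to `e` factors through `e` by a continuous linear map
defined on the whole Hilbert space. -/
lemma exists_continuousLinearMap_comp_eq {Φ X Y : Type*} [AddCommGroup Φ] [Module ℝ Φ]
    [NormedAddCommGroup X] [InnerProductSpace ℝ X] [CompleteSpace X] [NormedAddCommGroup Y]
    [NormedSpace ℝ Y] [CompleteSpace Y] (e : Φ →ₗ[ℝ] X) (f : Φ →ₗ[ℝ] Y) {C : ℝ} (hC : 0 ≤ C)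
    (h : ∀ φ, ‖f φ‖ ≤ C * ‖e φ‖) :
    ∃ F : X →L[ℝ] Y, (∀ φ, F (e φ) = f φ) ∧ ‖F‖ ≤ C := by
  set K := (LinearMap.range e).topologicalClosure
  have hK : IsClosed (K : Set X) := Submodule.isClosed_topologicalClosure _
  have : CompleteSpace K := hK.completeSpace_coe
  let e' : Φ →ₗ[ℝ] K := e.codRestrict K fun φ =>
    Submodule.le_topologicalClosure _ (LinearMap.mem_range_self e φ)
  have hd : DenseRange e' := by
    rw [DenseRange, Subtype.dense_iff]
    intro x hx
    have h1 : ((↑) : K → X) '' range e' = range e := by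
      rw [← range_comp]; rfl
    exact closure_mono h1.symm.subset hx
  have h' : ∀ φ, ‖f φ‖ ≤ C * ‖e' φ‖ := h
  refine ⟨(f.extendOfNorm e').comp K.orthogonalProjectionOnto, fun φ => ?_, ?_⟩
  · have h2 : K.orthogonalProjectionOnto (e φ) = e' φ :=
      Submodule.orthogonalProjectionOnto_mem_subspace_eq_self (e' φ)
    rw [ContinuousLinearMap.comp_apply, h2]
    exact LinearMap.extendOfNorm_eq hd ⟨C, h'⟩ φ
  · refine (ContinuousLinearMap.opNorm_comp_le _ _).trans ?_
    have h1 := LinearMap.opNorm_extendOfNorm_le (f := f) hd hC h'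
    have h2 := K.orthogonalProjectionOnto_norm_le
    calc _ ≤ C * 1 := by gcongr
      _ = C := mul_one C

/-- Lebesgue measure on the half-line `(0, ∞)`. -/
noncomputable abbrev halfLine : Measure ℝ := volume.restrict (Ioi 0)

lemma memLp_halfLine_of_continuous {E : Type*} [NormedAddCommGroup E] {φ : ℝ → E}
    (hφ : Continuous φ) {R : ℝ} (hR : ∀ t ≥ R, φ t = 0) : MemLp φ 2 halfLine := by
  rw [memLp_two_iff_integrable_sq_norm hφ.aestronglyMeasurable]
  have h1 : IntegrableOn (fun t => ‖φ t‖ ^ 2) (Icc 0 R) :=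
    (by fun_prop : Continuous fun t => ‖φ t‖ ^ 2).continuousOn.integrableOn_Icc
  refine h1.of_forall_sdiff_eq_zero measurableSet_Ioi fun t ht => ?_
  have : R ≤ t := by
    by_contra hlt
    exact ht.2 ⟨(mem_Ioi.1 ht.1).le, (not_le.1 hlt).le⟩
  simp [hR t this]

variable {V : Type*} [NormedAddCommGroup V] [InnerProductSpace ℝ V]

variable (V) in
/-- The test fields of time: continuously differentiable functions vanishing for large times, with
no condition at time `0`. -/
def testFields : Submodule ℝ (ℝ → V) where
  carrier := {φ | ContDiff ℝ 1 φ ∧ ∃ R, ∀ t ≥ R, φ t = 0}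
  zero_mem' := ⟨contDiff_const, 0, fun _ _ => rfl⟩
  add_mem' := by
    rintro φ ψ ⟨h1, R, h2⟩ ⟨h3, S, h4⟩
    refine ⟨h1.add h3, max R S, fun t ht => ?_⟩
    rw [Pi.add_apply, h2 t ((le_max_left _ _).trans ht), h4 t ((le_max_right _ _).trans ht),
      add_zero]
  smul_mem' := by
    rintro c φ ⟨h1, R, h2⟩
    exact ⟨h1.const_smul c, R, fun t ht => by rw [Pi.smul_apply, h2 t ht, smul_zero]⟩

namespace testFields

lemma memLp (φ : testFields V) : MemLp (φ : ℝ → V) 2 halfLine := by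
  obtain ⟨h1, R, h2⟩ := φ.2
  exact memLp_halfLine_of_continuous h1.continuous h2

lemma hasDerivAt (φ : testFields V) (t : ℝ) : HasDerivAt (φ : ℝ → V) (deriv φ t) t :=
  (φ.2.1.differentiable one_ne_zero t).hasDerivAt

lemma memLp_deriv (φ : testFields V) : MemLp (deriv (φ : ℝ → V)) 2 halfLine := by
  obtain ⟨h1, R, h2⟩ := φ.2
  refine memLp_halfLine_of_continuous (h1.continuous_deriv le_rfl) (R := R + 1) fun t ht => ?_
  have : (φ : ℝ → V) =ᶠ[𝓝 t] fun _ => 0 := by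
    filter_upwards [lt_mem_nhds (show R < t by linarith)] with s hs using h2 s hs.le
  rw [this.deriv_eq, deriv_const]

/-- Test fields as elements of `L²(0, ∞; V)`. -/
noncomputable def toL2 : testFields V →ₗ[ℝ] Lp V 2 halfLine where
  toFun φ := (memLp φ).toLp
  map_add' φ ψ := ((memLp φ).toLp_add (memLp ψ)).symm ▸ rfl
  map_smul' c φ := ((memLp φ).toLp_const_smul c).symm ▸ rfl

/-- Derivatives of test fields as elements of `L²(0, ∞; V)`. -/
noncomputable def derivL2 : testFields V →ₗ[ℝ] Lp V 2 halfLine where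
  toFun φ := (memLp_deriv φ).toLp
  map_add' φ ψ := by
    rw [← MemLp.toLp_add]
    congr 1
    funext t
    exact ((hasDerivAt φ t).add (hasDerivAt ψ t)).deriv
  map_smul' c φ := by
    rw [RingHom.id_apply, ← MemLp.toLp_const_smul]
    congr 1
    funext t
    exact ((hasDerivAt φ t).const_smul c).deriv

end testFields

variable {H : Type*} [CompleteSpace V] [NormedAddCommGroup H] [InnerProductSpace ℝ H]
  [CompleteSpace H] (j : V →L[ℝ] H)

lemma integral_inner_pivotOp_deriv (φ : testFields V) :
    inner ℝ (testFields.toL2 φ) ((pivotOp j).compLp (testFields.derivL2 φ))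
      = - (1 / 2) * ‖j ((φ : ℝ → V) 0)‖ ^ 2 := by
  have hd : ∀ t, HasDerivAt (fun t => (1 / 2 : ℝ) * ‖j ((φ : ℝ → V) t)‖ ^ 2)
      (inner ℝ ((φ : ℝ → V) t) (pivotOp j (deriv φ t))) t := by
    intro t
    have h1 := (j.hasFDerivAt.comp_hasDerivAt t (testFields.hasDerivAt φ t)).norm_sq.const_mul (1 / 2)
    convert! h1 using 1
    rw [real_inner_comm, inner_pivotOp_left, real_inner_comm]
    simp
  have hm : MemLp (fun t => pivotOp j (deriv φ t)) 2 halfLine :=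
    (pivotOp j).comp_memLp' (testFields.memLp_deriv φ)
  have h2 : Tendsto (fun t => (1 / 2 : ℝ) * ‖j ((φ : ℝ → V) t)‖ ^ 2) atTop (𝓝 0) := by
    obtain ⟨h1, R, hR⟩ := φ.2
    refine tendsto_const_nhds.congr' ?_
    filter_upwards [eventually_ge_atTop R] with t ht
    simp [hR t ht]
  have h3 := integral_Ioi_of_hasDerivAt_of_tendsto' (fun t _ => hd t)
    ((testFields.memLp φ).integrable_inner' hm) h2
  have h4 : (pivotOp j).compLp (testFields.derivL2 φ) = hm.toLp := by
    refine Lp.ext ?_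
    filter_upwards [(pivotOp j).coeFn_compLp (testFields.derivL2 φ), hm.coeFn_toLp,
      (testFields.memLp_deriv φ).coeFn_toLp] with t h1 h2 h3
    rw [h1, h2]
    exact congrArg _ h3
  rw [h4]
  refine ((testFields.memLp φ).inner_toLp_eq hm).trans ?_
  rw [h3]; ring

/-- Solvability of `P u' + κ u = h`, `u(0) = B₀`, in weak form, with a bound on the dependence on
the right-hand side. The form `(u, φ) ↦ -(P φ', u) + κ (φ, u)` is coercive on test fields, so
that `φ` and `j φ(0)` depend continuously on the functional it defines; the solution operators are
the adjoints of these dependences. -/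
lemma exists_linear_solution_operators {κ : ℝ} (hκ : 0 < κ) :
    ∃ (S : Lp V 2 halfLine →L[ℝ] Lp V 2 halfLine) (τ : H →L[ℝ] Lp V 2 halfLine), ‖S‖ ≤ κ⁻¹ ∧
      ∀ h B₀ (φ : testFields V),
        inner ℝ (S h + τ B₀) (κ • testFields.toL2 φ - (pivotOp j).compLp (testFields.derivL2 φ))
          = inner ℝ h (testFields.toL2 φ) + inner ℝ B₀ (j ((φ : ℝ → V) 0)) := by
  set e : testFields V →ₗ[ℝ] Lp V 2 halfLine :=
    κ • testFields.toL2 - ((pivotOp j).compLpL 2 halfLine).toLinearMap ∘ₗ testFields.derivL2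
  have he : ∀ φ, e φ = κ • testFields.toL2 φ - (pivotOp j).compLp (testFields.derivL2 φ) :=
    fun φ => rfl
  let f0 : testFields V →ₗ[ℝ] H := j.toLinearMap ∘ₗ LinearMap.proj 0 ∘ₗ (testFields V).subtype
  have hf0 : ∀ φ : testFields V, f0 φ = j ((φ : ℝ → V) 0) := fun φ => rfl
  have hco : ∀ φ, κ * ‖testFields.toL2 φ‖ ^ 2 + 1 / 2 * ‖f0 φ‖ ^ 2
      ≤ ‖testFields.toL2 φ‖ * ‖e φ‖ := by
    intro φ
    refine le_trans (le_of_eq ?_) (real_inner_le_norm (testFields.toL2 φ) (e φ))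
    rw [he, inner_sub_right, integral_inner_pivotOp_deriv, real_inner_smul_right,
      real_inner_self_eq_norm_sq, hf0]
    ring
  have h1 : ∀ φ, ‖testFields.toL2 φ‖ ≤ κ⁻¹ * ‖e φ‖ := by
    intro φ
    have h2 := hco φ
    rw [le_inv_mul_iff₀ hκ]
    rcases (norm_nonneg (testFields.toL2 φ)).eq_or_lt with h0 | h0
    · rw [← h0, mul_zero]; exact norm_nonneg _
    · refine le_of_mul_le_mul_left ?_ h0
      nlinarith [sq_nonneg ‖f0 φ‖]
  have h2 : ∀ φ, ‖f0 φ‖ ≤ √(2 * κ⁻¹) * ‖e φ‖ := by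
    intro φ
    have h3 : ‖f0 φ‖ ^ 2 ≤ 2 * κ⁻¹ * ‖e φ‖ ^ 2 := by
      have h4 := hco φ
      have h5 : ‖testFields.toL2 φ‖ * ‖e φ‖ ≤ κ⁻¹ * ‖e φ‖ * ‖e φ‖ := by
        gcongr; exact h1 φ
      nlinarith [mul_nonneg hκ.le (sq_nonneg ‖testFields.toL2 φ‖)]
    calc ‖f0 φ‖ ≤ √(2 * κ⁻¹ * ‖e φ‖ ^ 2) := Real.le_sqrt_of_sq_le h3
      _ = _ := by rw [Real.sqrt_mul (by positivity), Real.sqrt_sq (norm_nonneg _)]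
  obtain ⟨F, hF, hFn⟩ := exists_continuousLinearMap_comp_eq e testFields.toL2
    (inv_nonneg.2 hκ.le) h1
  obtain ⟨F0, hF0, -⟩ := exists_continuousLinearMap_comp_eq e f0 (Real.sqrt_nonneg _) h2
  refine ⟨ContinuousLinearMap.adjoint F, ContinuousLinearMap.adjoint F0, ?_, fun h B₀ φ => ?_⟩
  · rwa [LinearIsometryEquiv.norm_map]
  · rw [← he, inner_add_left, ContinuousLinearMap.adjoint_inner_left,
      ContinuousLinearMap.adjoint_inner_left, hF, hF0, hf0]

/-- Weak solvability of `P u' + N u = 0`, `u(0) = B₀`, for a Lipschitz and strongly monotone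
operator `N` on `L²(0, ∞; V)`: with `κ = L² / m`, the map `κ - N` has Lipschitz constant less than
`κ`, so that solving `P u' + κ u = κ v - N v` for `u` defines a contraction. -/
lemma exists_weak_solution_of_strongly_monotone (N : Lp V 2 halfLine → Lp V 2 halfLine) {m L : ℝ}
    (hm : 0 < m) (hmL : m < L) (hL : ∀ u v, ‖N u - N v‖ ≤ L * ‖u - v‖)
    (hmono : ∀ u v, m * ‖u - v‖ ^ 2 ≤ inner ℝ (N u - N v) (u - v)) (B₀ : H) :
    ∃ v : Lp V 2 halfLine, ∀ φ : testFields V,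
      inner ℝ (N v) (testFields.toL2 φ) - inner ℝ v ((pivotOp j).compLp (testFields.derivL2 φ))
        = inner ℝ B₀ (j ((φ : ℝ → V) 0)) := by
  have hL0 : 0 < L := hm.trans hmL
  set κ := L ^ 2 / m with hκdef
  have hκ : 0 < κ := by positivity
  have hκm : κ * m = L ^ 2 := by rw [hκdef]; field_simp
  obtain ⟨S, τ, hS, hST⟩ := exists_linear_solution_operators j hκ
  set q := √(1 - m ^ 2 / L ^ 2) with hq
  have hfrac : m ^ 2 / L ^ 2 < 1 := by rw [div_lt_one (by positivity)]; gcongr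
  have hqlt : q < 1 := by
    rw [hq, Real.sqrt_lt' one_pos]
    have : 0 < m ^ 2 / L ^ 2 := by positivity
    linarith
  set Ψ : Lp V 2 halfLine → Lp V 2 halfLine := fun v => S (κ • v - N v) + τ B₀
  have hcontr : ContractingWith ⟨q, Real.sqrt_nonneg _⟩ Ψ := by
    refine ⟨hqlt, LipschitzWith.of_dist_le_mul fun u v => ?_⟩
    have h1 : Ψ u - Ψ v = S (κ • (u - v) - (N u - N v)) := by
      simp only [Ψ]
      rw [add_sub_add_right_eq_sub, ← map_sub]
      congr 1
      rw [smul_sub]; abel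
    have h2 : ‖κ • (u - v) - (N u - N v)‖ ^ 2 ≤ (κ * (q * ‖u - v‖)) ^ 2 := by
      rw [norm_sub_sq_real, real_inner_smul_left, norm_smul, Real.norm_of_nonneg hκ.le]
      have h3 := hmono u v
      rw [real_inner_comm] at h3
      have h4 : ‖N u - N v‖ ^ 2 ≤ L ^ 2 * ‖u - v‖ ^ 2 := by
        rw [← mul_pow]; gcongr; exact hL u v
      have h5 : (κ * (q * ‖u - v‖)) ^ 2 = (κ ^ 2 - L ^ 2) * ‖u - v‖ ^ 2 := by
        rw [mul_pow, mul_pow, hq, Real.sq_sqrt (by linarith), hκdef]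
        field_simp
      rw [h5]
      have h6 : κ * (m * ‖u - v‖ ^ 2) ≤ κ * inner ℝ (u - v) (N u - N v) := by gcongr
      rw [← mul_assoc, hκm] at h6
      nlinarith
    have h7 := abs_le_of_sq_le_sq h2 (by positivity)
    rw [abs_of_nonneg (norm_nonneg _)] at h7
    rw [dist_eq_norm, dist_eq_norm, h1]
    calc _ ≤ ‖S‖ * ‖κ • (u - v) - (N u - N v)‖ := S.le_opNorm _
      _ ≤ κ⁻¹ * (κ * (q * ‖u - v‖)) := by gcongr
      _ = q * ‖u - v‖ := by field_simp
  refine ⟨hcontr.fixedPoint Ψ, fun φ => ?_⟩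
  set v := hcontr.fixedPoint Ψ
  have hv : S (κ • v - N v) + τ B₀ = v := hcontr.fixedPoint_isFixedPt
  have := hST (κ • v - N v) B₀ φ
  rw [hv, inner_sub_right, inner_sub_left, real_inner_smul_left, real_inner_smul_right] at this
  linarith

end Lions

/-! ### Even reflection -/

section Reflection

open Filter Topology

lemma map_abs_volume : (volume : Measure ℝ).map (fun t => |t|) = (2 : ℝ≥0∞) • halfLine := by
  have hm : Measurable (fun t : ℝ => |t|) := by fun_prop
  have h1 : halfLine.map (fun t => |t|) = halfLine := by
    have : (fun t : ℝ => |t|) =ᵐ[halfLine] id := by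
      filter_upwards [ae_restrict_mem measurableSet_Ioi] with t ht using abs_of_pos ht
    rw [Measure.map_congr this, Measure.map_id]
  have h2 : (volume.restrict (Iio (0 : ℝ))).map (fun t => |t|) = halfLine := by
    have h3 : (volume.restrict (Ioi (0 : ℝ))).map (fun t => -t) = volume.restrict (Iio 0) := by
      have := (Measure.measurePreserving_neg (volume : Measure ℝ)).restrict_preimage
        (measurableSet_Iio (a := (0 : ℝ)))
      have h4 : (Neg.neg ⁻¹' Iio (0 : ℝ)) = Ioi 0 := by ext; simp
      rw [h4] at this
      exact this.map_eq
    rw [← h3, Measure.map_map hm measurable_neg]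
    simp only [Function.comp_def, abs_neg]
    exact h1
  have h5 : (volume : Measure ℝ) = volume.restrict (Iio 0) + volume.restrict (Ioi 0) := by
    have := Measure.restrict_add_restrict_compl (μ := (volume : Measure ℝ))
      (measurableSet_Iic (a := (0 : ℝ)))
    rw [compl_Iic, ← restrict_Iio_eq_restrict_Iic] at this
    exact this.symm
  rw [h5, Measure.map_add _ _ hm, h1, h2, two_smul]

lemma ae_comp_abs {p : ℝ → Prop} (h : ∀ᵐ t ∂halfLine, p t) : ∀ᵐ t : ℝ, p |t| := by
  have hm : AEMeasurable (fun t : ℝ => |t|) volume := by fun_prop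
  refine ae_of_ae_map hm ?_
  rw [map_abs_volume]
  exact Measure.ae_smul_measure h 2

variable {E : Type*} [NormedAddCommGroup E]

lemma memLp_comp_abs {v : ℝ → E} (hv : MemLp v 2 halfLine) :
    MemLp (fun t => v |t|) 2 volume := by
  have hm : AEMeasurable (fun t : ℝ => |t|) volume := by fun_prop
  have h1 : MemLp v 2 ((volume : Measure ℝ).map (fun t => |t|)) := by
    rw [map_abs_volume]; exact hv.smul_measure (by simp)
  exact h1.comp_of_map hm

/-- The odd reflection of a function on the half-line. -/
noncomputable def oddReflection (g : ℝ → E) (t : ℝ) : E :=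
  (Ioi 0).indicator (fun t => g |t|) t - (Iio 0).indicator (fun t => g |t|) t

lemma oddReflection_of_pos (g : ℝ → E) {t : ℝ} (ht : 0 < t) : oddReflection g t = g t := by
  simp [oddReflection, ht, ht.le, abs_of_pos]

lemma oddReflection_neg (g : ℝ → E) (t : ℝ) : oddReflection g (-t) = - oddReflection g t := by
  rcases lt_trichotomy t 0 with h | rfl | h
  · simp [oddReflection, h, h.le]
  · simp [oddReflection]
  · simp [oddReflection, h, h.le]

lemma memLp_oddReflection {g : ℝ → E} (hg : MemLp g 2 halfLine) :
    MemLp (oddReflection g) 2 volume :=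
  ((memLp_comp_abs hg).indicator measurableSet_Ioi).sub
    ((memLp_comp_abs hg).indicator measurableSet_Iio)

lemma integral_oddReflection_neg [NormedSpace ℝ E] (g : ℝ → E) (t : ℝ) :
    ∫ s in (0 : ℝ)..(-t), oddReflection g s = ∫ s in (0 : ℝ)..t, oddReflection g s := by
  have := intervalIntegral.integral_comp_neg (a := 0) (b := t) (oddReflection g)
  simp only [oddReflection_neg, intervalIntegral.integral_neg, neg_zero] at this
  rw [intervalIntegral.integral_symm, ← this, neg_neg]

end Reflection

/-! ### Evolution problems on the half-line -/

section HalfLine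

open Filter Topology

variable {V : Type*} [NormedAddCommGroup V] [InnerProductSpace ℝ V] [CompleteSpace V]

lemma MeasureTheory.MemLp.integrable_smul_two {α E : Type*} [MeasurableSpace α] {μ : Measure α}
    [NormedAddCommGroup E] [NormedSpace ℝ E] {θ : α → ℝ} {p : α → E} (hθ : MemLp θ 2 μ)
    (hp : MemLp p 2 μ) : Integrable (fun t => θ t • p t) μ :=
  memLp_one_iff_integrable.1 (hp.smul hθ)

lemma memLp_comp_of_lipschitz {E : Type*} [NormedAddCommGroup E] {μ : Measure ℝ} {n : ℝ → E → E}
    {L : ℝ} (hmeas : ∀ v : ℝ → E, AEStronglyMeasurable v μ →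
      AEStronglyMeasurable (fun t => n t (v t)) μ)
    (hn0 : ∀ᵐ t ∂μ, n t 0 = 0)
    (hL : ∀ᵐ t ∂μ, ∀ u v, ‖n t u - n t v‖ ≤ L * ‖u - v‖) {v : ℝ → E} (hv : MemLp v 2 μ) :
    MemLp (fun t => n t (v t)) 2 μ := by
  refine hv.of_le_mul (hmeas v hv.1) (c := L) ?_
  filter_upwards [hn0, hL] with t h1 h2
  simpa [h1] using h2 (v t) 0

/-- Weak formulation implies integrated formulation: testing with scalar functions that need not
vanish at time `0` recovers the initial value. -/
lemma ae_eq_primitive_of_weak {p g : ℝ → V} (hp : MemLp p 2 halfLine) (hg : MemLp g 2 halfLine)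
    {c : V} (h : ∀ θ : ℝ → ℝ, ContDiff ℝ 1 θ → (∃ R, ∀ t ≥ R, θ t = 0) →
      (∫ t in Ioi 0, deriv θ t • p t) + ∫ t in Ioi 0, θ t • g t = - (θ 0 • c)) :
    ∀ᵐ t ∂halfLine, p t = c + ∫ s in (0 : ℝ)..t, oddReflection g s := by
  set G := oddReflection g
  have hG : MemLp G 2 volume := memLp_oddReflection hg
  have hpc : Continuous fun t => c + ∫ s in (0 : ℝ)..t, G s :=
    continuous_const.add (intervalIntegral.continuous_primitive hG.intervalIntegrable_two 0)
  have hli : LocallyIntegrable (fun t => p t - (c + ∫ s in (0 : ℝ)..t, G s)) halfLine :=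
    (hp.locallyIntegrable (by norm_num)).sub hpc.locallyIntegrable
  have key : ∀ ψ : ℝ → ℝ, ContDiff ℝ ∞ ψ → HasCompactSupport ψ → tsupport ψ ⊆ Ioi 0 →
      ∫ t, ψ t • (p t - (c + ∫ s in (0 : ℝ)..t, G s)) ∂halfLine = 0 := by
    intro ψ hψ hψk hψs
    obtain ⟨R, hR0, hR⟩ : ∃ R > 0, ∀ t ≥ R, ψ t = 0 := by
      obtain ⟨R, hR⟩ := hψk.isCompact.bddAbove
      refine ⟨max R 0 + 1, by positivity, fun t ht => image_eq_zero_of_notMem_tsupport fun hm => ?_⟩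
      have := hR hm
      have := le_max_left R 0
      linarith
    have hneg : ∀ t ≤ 0, ψ t = 0 := fun t ht =>
      image_eq_zero_of_notMem_tsupport fun hm => absurd (hψs hm) (not_lt.2 ht)
    obtain ⟨hΨ, hΨd⟩ := contDiff_primitive hψ
    set I := ∫ s in (0 : ℝ)..R, ψ s with hI
    -- the test function with derivative `-ψ` that vanishes beyond the support of `ψ`
    set θ : ℝ → ℝ := fun t => I - ∫ s in (0 : ℝ)..t, ψ s with hθ
    have hθc : ContDiff ℝ 1 θ := contDiff_const.sub (hΨ.of_le (by simp))
    have hθd : ∀ t, deriv θ t = -ψ t := fun t => by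
      rw [hθ, deriv_const_sub, hΨd]
    have hθR : ∀ t ≥ R, θ t = 0 := by
      intro t ht
      have : ∫ s in R..t, ψ s = 0 := by
        rw [intervalIntegral.integral_congr (g := fun _ => 0)]
        · simp
        · intro s hs
          rw [uIcc_of_le ht] at hs
          exact hR s hs.1
      simp only [hθ, hI]
      rw [← intervalIntegral.integral_add_adjacent_intervals
        (hψ.continuous.intervalIntegrable 0 R) (hψ.continuous.intervalIntegrable R t), this]
      simp
    have hθ0 : θ 0 = I := by simp [hθ]
    have h1 := h θ hθc ⟨R, hθR⟩
    have hrestr : ∀ f : ℝ → V, (∀ t ≥ R, f t = 0) → ∫ t in Ioi 0, f t = ∫ t in (0 : ℝ)..R, f t := by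
      intro f hf
      rw [intervalIntegral.integral_of_le hR0.le]
      refine (setIntegral_eq_of_subset_of_forall_sdiff_eq_zero measurableSet_Ioi
        Ioc_subset_Ioi_self fun t ht => hf t ?_)
      by_contra hlt
      exact ht.2 ⟨ht.1, (not_le.1 hlt).le⟩
    have h2 := integral_deriv_smul_primitive hθc (hθR R le_rfl) (hG.intervalIntegrable_two 0 R)
    have h3 : ∫ t in Ioi 0, θ t • g t = ∫ t in (0 : ℝ)..R, θ t • G t := by
      rw [hrestr _ fun t ht => by rw [hθR t ht, zero_smul]]
      refine intervalIntegral.integral_congr_ae (Eventually.of_forall fun t ht => ?_)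
      rw [uIoc_of_le hR0.le] at ht
      simp only [G]
      rw [oddReflection_of_pos g ht.1]
    simp only [hθd, neg_smul, intervalIntegral.integral_neg, integral_neg] at h1 h2
    obtain ⟨C, hC⟩ := hψ.continuous.bounded_above_of_compact_support hψk
    have hψi : Integrable ψ halfLine :=
      (hψ.continuous.integrable_of_hasCompactSupport hψk).integrableOn
    have hi1 : Integrable (fun t => ψ t • p t) halfLine :=
      (MemLp.integrable_smul_two
        (hψ.continuous.memLp_of_hasCompactSupport hψk) hp)
    have hi2 : Integrable (fun t => ψ t • ∫ s in (0 : ℝ)..t, G s) halfLine :=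
      ((hψ.continuous.smul
        (intervalIntegral.continuous_primitive hG.intervalIntegrable_two 0)
        ).integrable_of_hasCompactSupport hψk.smul_right).integrableOn
    have hIψ : ∫ t in Ioi 0, ψ t = I := by
      rw [hI, intervalIntegral.integral_of_le hR0.le]
      refine setIntegral_eq_of_subset_of_forall_sdiff_eq_zero measurableSet_Ioi
        Ioc_subset_Ioi_self fun t ht => hR t ?_
      by_contra hlt
      exact ht.2 ⟨ht.1, (not_le.1 hlt).le⟩
    have h4 : ∫ t in Ioi 0, ψ t • (∫ s in (0 : ℝ)..t, G s)
        = ∫ t in (0 : ℝ)..R, ψ t • (∫ s in (0 : ℝ)..t, G s) :=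
      hrestr _ fun t ht => by rw [hR t ht, zero_smul]
    have h5 : ∀ t, ψ t • (p t - (c + ∫ s in (0 : ℝ)..t, G s))
        = ψ t • p t - (ψ t • c + ψ t • ∫ s in (0 : ℝ)..t, G s) := fun t => by
      rw [smul_sub, smul_add]
    have hi3 : Integrable (fun t => ψ t • c + ψ t • ∫ s in (0 : ℝ)..t, G s) halfLine :=
      (hψi.smul_const c).add hi2
    simp only [h5]
    rw [integral_sub hi1 hi3, integral_add (hψi.smul_const c) hi2,
      integral_smul_const, hIψ, h4]
    rw [h3, hθ0] at h1
    rw [neg_inj] at h2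
    rw [h2, sub_eq_zero]
    rw [neg_add_eq_iff_eq_add] at h1
    rw [eq_comm, ← sub_eq_zero]
    rw [h1]
    abel
  have := isOpen_Ioi.ae_eq_zero_of_integral_contDiff_smul_eq_zero
    (hli.locallyIntegrableOn _) key
  filter_upwards [this, ae_restrict_mem measurableSet_Ioi] with t ht hm
  exact sub_eq_zero.1 (ht hm)

variable {H : Type*} [NormedAddCommGroup H] [InnerProductSpace ℝ H] [CompleteSpace H]

/-- Existence on the half-line for `P u' + n(t, u) = 0`, `u(0) = B₀`, with `n(t, ·)` uniformly
Lipschitz and strongly monotone. -/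
theorem exists_halfLine_solution {j : V →L[ℝ] H} (hj : DenseRange j) {n : ℝ → V → V} {m L : ℝ}
    (hm : 0 < m) (hmL : m < L)
    (hmeas : ∀ v : ℝ → V, AEStronglyMeasurable v halfLine →
      AEStronglyMeasurable (fun t => n t (v t)) halfLine)
    (hn0 : ∀ᵐ t ∂halfLine, n t 0 = 0)
    (hL : ∀ᵐ t ∂halfLine, ∀ u v, ‖n t u - n t v‖ ≤ L * ‖u - v‖)
    (hmono : ∀ᵐ t ∂halfLine, ∀ u v, m * ‖u - v‖ ^ 2 ≤ inner ℝ (n t u - n t v) (u - v))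
    (B₀ : H) :
    ∃ v : ℝ → V, MemLp v 2 halfLine ∧ MemLp (fun t => n t (v t)) 2 halfLine ∧
      (∀ θ : ℝ → ℝ, ContDiff ℝ 1 θ → (∃ R, ∀ t ≥ R, θ t = 0) → θ 0 = 0 →
        ∫ t in Ioi 0, deriv θ t • pivotOp j (v t) = ∫ t in Ioi 0, θ t • n t (v t)) ∧
      ∃ x : ℝ → H, Continuous x ∧ x 0 = B₀ ∧ ∀ᵐ t ∂halfLine, x t = j (v t) := by
  have hmem : ∀ v : ℝ → V, MemLp v 2 halfLine → MemLp (fun t => n t (v t)) 2 halfLine :=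
    fun v hv => memLp_comp_of_lipschitz hmeas hn0 hL hv
  set N : Lp V 2 halfLine → Lp V 2 halfLine := fun v => (hmem v (Lp.memLp v)).toLp
  have hN : ∀ v : Lp V 2 halfLine, N v =ᵐ[halfLine] fun t => n t (v t) := fun v =>
    MemLp.coeFn_toLp _
  have hNL : ∀ u v, ‖N u - N v‖ ≤ L * ‖u - v‖ := by
    intro u v
    refine Lp.norm_le_mul_norm_of_ae_le_mul ?_
    filter_upwards [hN u, hN v, Lp.coeFn_sub u v, Lp.coeFn_sub (N u) (N v), hL] with t h1 h2 h3 h4 h5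
    rw [h3, h4, Pi.sub_apply, Pi.sub_apply, h1, h2]
    exact h5 _ _
  have hNm : ∀ u v, m * ‖u - v‖ ^ 2 ≤ inner ℝ (N u - N v) (u - v) := by
    intro u v
    rw [← real_inner_self_eq_norm_sq, L2.inner_def, L2.inner_def, ← integral_const_mul]
    refine integral_mono_ae ((L2.integrable_inner _ _).const_mul m) (L2.integrable_inner _ _) ?_
    filter_upwards [hN u, hN v, Lp.coeFn_sub u v, Lp.coeFn_sub (N u) (N v), hmono] with
      t h1 h2 h3 h4 h5
    rw [h3, h4, Pi.sub_apply, Pi.sub_apply, h1, h2, real_inner_self_eq_norm_sq]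
    exact h5 _ _
  obtain ⟨v, hv⟩ := exists_weak_solution_of_strongly_monotone j N hm hmL hNL hNm B₀
  have hvm : MemLp v 2 halfLine := Lp.memLp v
  have hnm := hmem v hvm
  have hPm : MemLp (fun t => pivotOp j (v t)) 2 halfLine := (pivotOp j).comp_memLp' hvm
  -- the weak formulation with the test fields `θ • A`
  have hweak : ∀ θ : ℝ → ℝ, ContDiff ℝ 1 θ → (∃ R, ∀ t ≥ R, θ t = 0) →
      (∫ t in Ioi 0, deriv θ t • pivotOp j (v t)) + ∫ t in Ioi 0, θ t • -n t (v t)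
        = -(θ 0 • ContinuousLinearMap.adjoint j B₀) := by
    intro θ hθ hR
    obtain ⟨R, hR⟩ := hR
    have hθd : MemLp (deriv θ) 2 halfLine := by
      refine memLp_halfLine_of_continuous (hθ.continuous_deriv le_rfl) (R := R + 1) fun t ht => ?_
      have : θ =ᶠ[𝓝 t] fun _ => 0 := by
        filter_upwards [lt_mem_nhds (show R < t by linarith)] with s hs using hR s hs.le
      rw [this.deriv_eq, deriv_const]
    have hθm : MemLp θ 2 halfLine := memLp_halfLine_of_continuous hθ.continuous hR
    have hi1 : Integrable (fun t => deriv θ t • pivotOp j (v t)) halfLine :=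
      MemLp.integrable_smul_two hθd hPm
    have hi2 : Integrable (fun t => θ t • -n t (v t)) halfLine :=
      MemLp.integrable_smul_two hθm hnm.neg
    refine ext_inner_right ℝ fun A => ?_
    rw [inner_add_left, real_inner_comm, real_inner_comm A (∫ t in Ioi 0, θ t • -n t (v t)),
      ← integral_inner hi1, ← integral_inner hi2, inner_neg_left, real_inner_smul_left,
      ContinuousLinearMap.adjoint_inner_left]
    let φ : testFields V := ⟨fun t => θ t • A, hθ.smul contDiff_const, R, fun t ht => by
      simp only [hR t ht, zero_smul]⟩
    have hφd : ∀ t, deriv (φ : ℝ → V) t = deriv θ t • A := fun t =>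
      ((hθ.differentiable one_ne_zero t).hasDerivAt.smul_const A).deriv
    have h1 := hv φ
    rw [L2.inner_def, L2.inner_def] at h1
    have h2 : ∫ t, inner ℝ (N v t) (testFields.toL2 φ t) ∂halfLine
        = - ∫ t, inner ℝ A (θ t • -n t (v t)) ∂halfLine := by
      rw [← integral_neg]
      refine integral_congr_ae ?_
      filter_upwards [hN v, (testFields.memLp φ).coeFn_toLp] with t h3 h4
      have h5 : testFields.toL2 φ t = θ t • A := h4
      rw [h3, h5, smul_neg, inner_neg_right, neg_neg, real_inner_smul_right, real_inner_smul_right,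
        real_inner_comm]
    have h6 : ∫ t, inner ℝ (v t) ((pivotOp j).compLp (testFields.derivL2 φ) t) ∂halfLine
        = ∫ t, inner ℝ A (deriv θ t • pivotOp j (v t)) ∂halfLine := by
      refine integral_congr_ae ?_
      filter_upwards [(pivotOp j).coeFn_compLp (testFields.derivL2 φ),
        (testFields.memLp_deriv φ).coeFn_toLp] with t h3 h4
      have h5 : testFields.derivL2 φ t = deriv θ t • A := h4.trans (hφd t)
      rw [h3, h5, map_smul, real_inner_smul_right, real_inner_smul_right,
        real_inner_comm (pivotOp j (v t)) A, inner_pivotOp_left, real_inner_comm,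
        inner_pivotOp_left, real_inner_comm]
    have h7 : j ((φ : ℝ → V) 0) = θ 0 • j A := map_smul j _ _
    rw [h2, h6, h7, real_inner_smul_right] at h1
    linarith
  have hprim := ae_eq_primitive_of_weak hPm hnm.neg hweak
  -- the even reflection of `v` has the odd reflection of `-n(t, v)` as its derivative
  set G := oddReflection (-fun t => n t (v t)) with hGdef
  have hG : MemLp G 2 volume := memLp_oddReflection hnm.neg
  set w : ℝ → V := fun t => ContinuousLinearMap.adjoint j B₀ + ∫ s in (0 : ℝ)..t, G s with hwdef
  have hw : ∀ s t, w t - w s = ∫ x in s..t, G x := fun s t => by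
    simp only [hwdef]
    rw [add_sub_add_left_eq_sub, intervalIntegral.integral_interval_sub_left] <;>
      exact hG.intervalIntegrable_two _ _
  have hweven : ∀ t, w |t| = w t := fun t => by
    rcases abs_choice t with h | h
    · rw [h]
    · rw [h]; simp only [hwdef]; rw [hGdef, integral_oddReflection_neg]
  have hUw : ∀ᵐ t : ℝ, pivotOp j (v |t|) = w t := by
    filter_upwards [ae_comp_abs hprim] with t ht
    rw [ht]; exact hweven t
  obtain ⟨x, hxc, hx⟩ := exists_continuous_representative hj (memLp_comp_abs hvm) hG hw hUw
  refine ⟨v, hvm, hnm, fun θ hθ hR hθ0 => ?_, x, hxc, ?_, ?_⟩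
  · have := hweak θ hθ hR
    simp only [hθ0, zero_smul, neg_zero, smul_neg, integral_neg] at this
    exact add_neg_eq_zero.1 this
  · refine eq_of_forall_inner_denseRange_eq hj fun A => ?_
    rw [hx, ← ContinuousLinearMap.adjoint_inner_left]
    simp [hwdef]
  · filter_upwards [hprim] with t ht
    refine eq_of_forall_inner_denseRange_eq hj fun A => ?_
    rw [hx, ← inner_pivotOp_left, ht]

end HalfLine

/-! ### Existence on a bounded time interval -/

section BoundedInterval

open Filter Topology Dynamo

variable {V : Type*} [NormedAddCommGroup V] [InnerProductSpace ℝ V] [CompleteSpace V]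
variable {H : Type*} [NormedAddCommGroup H] [InnerProductSpace ℝ H] [CompleteSpace H]

/-- Existence for `P u' + n(t, u) = 0`, `u(0) = B₀` on `(0, T)` under a Gårding inequality. The
exponential weight `u = e^{l t} v` makes the operator strongly monotone. -/
theorem exists_solution_of_garding {j : V →L[ℝ] H} (hj : DenseRange j) {T : ℝ} {n : ℝ → V → V}
    {m L l : ℝ} (hm : 0 < m)
    (hmeas : ∀ v : ℝ → V, AEStronglyMeasurable v (timeMeasure T) →
      AEStronglyMeasurable (fun t => n t (v t)) (timeMeasure T))
    (hn0 : ∀ᵐ t ∂(timeMeasure T), n t 0 = 0)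
    (hL : ∀ᵐ t ∂(timeMeasure T), ∀ u v, ‖n t u - n t v‖ ≤ L * ‖u - v‖)
    (hmono : ∀ᵐ t ∂(timeMeasure T), ∀ u v,
      m * ‖u - v‖ ^ 2 ≤ inner ℝ (n t u - n t v) (u - v) + l * ‖j (u - v)‖ ^ 2)
    (B₀ : H) :
    ∃ u : ℝ → V, MemLp u 2 (timeMeasure T) ∧ MemLp (fun t => n t (u t)) 2 (timeMeasure T) ∧
      IsWeakTimeDeriv T (fun t => pivotOp j (u t)) (fun t => -n t (u t)) ∧
      ∃ x : ℝ → H, Continuous x ∧ x 0 = B₀ ∧ ∀ᵐ t ∂(timeMeasure T), x t = j (u t) := by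
  classical
  have hle : timeMeasure T ≤ halfLine := Measure.restrict_mono Ioo_subset_Ioi_self le_rfl
  have hrr : halfLine.restrict (Ioo 0 T) = timeMeasure T := by
    rw [Measure.restrict_restrict measurableSet_Ioo, inter_eq_left.2 Ioo_subset_Ioi_self]
  -- the operator for `v = e^{-l t} u`, continued to later times by a strongly monotone one
  set N : ℝ → V → V := fun t v => if t ∈ Ioo 0 T then
    Real.exp (-(l * t)) • n t (Real.exp (l * t) • v) + l • pivotOp j v else m • v with hNdef
  have hNin : ∀ {t}, t ∈ Ioo 0 T → ∀ v, N t v =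
      Real.exp (-(l * t)) • n t (Real.exp (l * t) • v) + l • pivotOp j v := fun ht v => if_pos ht
  have hNout : ∀ {t}, t ∉ Ioo 0 T → ∀ v, N t v = m • v := fun ht v => if_neg ht
  have hexp : ∀ t, Real.exp (-(l * t)) * Real.exp (l * t) = 1 := fun t => by
    rw [← Real.exp_add]; simp
  have hcexp : Continuous fun t : ℝ => Real.exp (l * t) := by fun_prop
  have hcexp' : Continuous fun t : ℝ => Real.exp (-(l * t)) := by fun_prop
  set L' := |L| + |l| * ‖pivotOp j‖ + m + 1 with hL'
  have hmL : m < L' := by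
    have := abs_nonneg L
    have := mul_nonneg (abs_nonneg l) (norm_nonneg (pivotOp j))
    rw [hL']; linarith
  -- a property of the operator on `(0, T)` and outside holds almost everywhere on the half-line
  have hsplit : ∀ {p : ℝ → Prop}, (∀ᵐ t ∂(timeMeasure T), p t) → (∀ t ∉ Ioo 0 T, p t) →
      ∀ᵐ t ∂halfLine, p t := by
    intro p h1 h2
    rw [ae_restrict_iff' measurableSet_Ioo] at h1
    refine ae_restrict_of_ae ?_
    filter_upwards [h1] with t ht
    by_cases htm : t ∈ Ioo 0 T
    · exact ht htm
    · exact h2 t htm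
  have hNmeas : ∀ v : ℝ → V, AEStronglyMeasurable v halfLine →
      AEStronglyMeasurable (fun t => N t (v t)) halfLine := by
    intro v hv
    have h1 : (fun t => N t (v t)) = (Ioo 0 T).piecewise
        (fun t => Real.exp (-(l * t)) • n t (Real.exp (l * t) • v t) + l • pivotOp j (v t))
        (fun t => m • v t) := rfl
    rw [h1]
    refine AEStronglyMeasurable.piecewise measurableSet_Ioo ?_ (hv.const_smul m).restrict
    rw [hrr]
    have hv' : AEStronglyMeasurable v (timeMeasure T) := hv.mono_measure hle
    exact (hcexp'.aestronglyMeasurable.smul (hmeas _ (hcexp.aestronglyMeasurable.smul hv'))).add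
      (((pivotOp j).continuous.comp_aestronglyMeasurable hv').const_smul l)
  have hN0 : ∀ᵐ t ∂halfLine, N t 0 = 0 := by
    refine hsplit ?_ fun t ht => by rw [hNout ht, smul_zero]
    filter_upwards [hn0, ae_restrict_mem measurableSet_Ioo] with t ht htm
    rw [hNin htm]; simp [ht]
  have hNL : ∀ᵐ t ∂halfLine, ∀ u v, ‖N t u - N t v‖ ≤ L' * ‖u - v‖ := by
    refine hsplit ?_ fun t ht u v => ?_
    · filter_upwards [hL, ae_restrict_mem measurableSet_Ioo] with t ht htm u v
      have h1 : N t u - N t v = Real.exp (-(l * t)) •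
          (n t (Real.exp (l * t) • u) - n t (Real.exp (l * t) • v)) + l • pivotOp j (u - v) := by
        rw [hNin htm, hNin htm, map_sub, smul_sub, smul_sub]; abel
      have h2 := ht (Real.exp (l * t) • u) (Real.exp (l * t) • v)
      rw [← smul_sub, norm_smul, Real.norm_of_nonneg (Real.exp_pos _).le] at h2
      calc ‖N t u - N t v‖ ≤ Real.exp (-(l * t)) * (L * (Real.exp (l * t) * ‖u - v‖))
            + |l| * (‖pivotOp j‖ * ‖u - v‖) := by
            rw [h1]
            refine (norm_add_le _ _).trans (add_le_add ?_ ?_)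
            · rw [norm_smul, Real.norm_of_nonneg (Real.exp_pos _).le]
              gcongr
            · rw [norm_smul, Real.norm_eq_abs]
              gcongr
              exact (pivotOp j).le_opNorm _
        _ = (L + |l| * ‖pivotOp j‖) * ‖u - v‖ := by
            linear_combination L * ‖u - v‖ * hexp t
        _ ≤ L' * ‖u - v‖ := by
            gcongr
            rw [hL']; linarith [le_abs_self L]
    · rw [hNout ht, hNout ht, ← smul_sub, norm_smul, Real.norm_of_nonneg hm.le]
      gcongr
  have hNm : ∀ᵐ t ∂halfLine, ∀ u v, m * ‖u - v‖ ^ 2 ≤ inner ℝ (N t u - N t v) (u - v) := by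
    refine hsplit ?_ fun t ht u v => ?_
    · filter_upwards [hmono, ae_restrict_mem measurableSet_Ioo] with t ht htm u v
      have h1 : N t u - N t v = Real.exp (-(l * t)) •
          (n t (Real.exp (l * t) • u) - n t (Real.exp (l * t) • v)) + l • pivotOp j (u - v) := by
        rw [hNin htm, hNin htm, map_sub, smul_sub, smul_sub]; abel
      have h2 := ht (Real.exp (l * t) • u) (Real.exp (l * t) • v)
      rw [← smul_sub, map_smul, norm_smul, norm_smul, real_inner_smul_right,
        Real.norm_of_nonneg (Real.exp_pos _).le, mul_pow, mul_pow] at h2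
      rw [h1, inner_add_left, real_inner_smul_left, real_inner_smul_left, inner_pivotOp_left,
        real_inner_self_eq_norm_sq]
      set I := inner ℝ (n t (Real.exp (l * t) • u) - n t (Real.exp (l * t) • v)) (u - v)
      have h3 := mul_le_mul_of_nonneg_left h2 (sq_nonneg (Real.exp (-(l * t))))
      have h4 : Real.exp (-(l * t)) ^ 2 * Real.exp (l * t) ^ 2 = 1 := by
        rw [← mul_pow, hexp, one_pow]
      have h5 : Real.exp (-(l * t)) ^ 2 * (m * (Real.exp (l * t) ^ 2 * ‖u - v‖ ^ 2))
          = m * ‖u - v‖ ^ 2 := by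
        linear_combination m * ‖u - v‖ ^ 2 * h4
      have h6 : Real.exp (-(l * t)) ^ 2 * (Real.exp (l * t) * I
            + l * (Real.exp (l * t) ^ 2 * ‖j (u - v)‖ ^ 2))
          = Real.exp (-(l * t)) * I + l * ‖j (u - v)‖ ^ 2 := by
        linear_combination l * ‖j (u - v)‖ ^ 2 * h4 + Real.exp (-(l * t)) * I * hexp t
      rw [h5, h6] at h3
      exact h3
    · rw [hNout ht, hNout ht, ← smul_sub, real_inner_smul_left, real_inner_self_eq_norm_sq]
  obtain ⟨v, hv, hNv, hweak, x, hxc, hx0, hx⟩ :=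
    exists_halfLine_solution hj hm hmL hNmeas hN0 hNL hNm B₀
  have hvT : MemLp v 2 (timeMeasure T) := hv.mono_measure hle
  have hu : MemLp (fun t => Real.exp (l * t) • v t) 2 (timeMeasure T) := by
    refine hvT.of_le_mul (hcexp.aestronglyMeasurable.smul hvT.1) (c := Real.exp (|l| * T)) ?_
    filter_upwards [ae_restrict_mem measurableSet_Ioo] with t ht
    rw [norm_smul, Real.norm_of_nonneg (Real.exp_pos _).le]
    gcongr
    · exact ht.1.le
    · exact le_abs_self l
    · exact ht.2.le
  have hnu := memLp_comp_of_lipschitz hmeas hn0 hL hu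
  refine ⟨fun t => Real.exp (l * t) • v t, hu, hnu, ?_, fun t => Real.exp (l * t) • x t,
    hcexp.smul hxc, by simp [hx0], ?_⟩
  · intro φ hφ hφk hφs
    have hφ0 : ∀ t ∉ Ioo 0 T, φ t = 0 := fun t ht =>
      image_eq_zero_of_notMem_tsupport fun hm => ht (hφs hm)
    have hφd0 : ∀ t ∉ Ioo 0 T, deriv φ t = 0 := fun t ht =>
      image_eq_zero_of_notMem_tsupport fun hm => ht (hφs (tsupport_deriv_subset hm))
    have hφd : Continuous (deriv φ) := hφ.continuous_deriv (by simp)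
    set θ : ℝ → ℝ := fun t => Real.exp (l * t) * φ t with hθ
    have hθd : ∀ t, deriv θ t = Real.exp (l * t) * deriv φ t + l * (Real.exp (l * t) * φ t) := by
      intro t
      have h1 : HasDerivAt (fun t : ℝ => Real.exp (l * t)) (Real.exp (l * t) * (l * 1)) t :=
        ((hasDerivAt_id t).const_mul l).exp
      have h2 : HasDerivAt θ _ t := h1.mul (hφ.differentiable (by simp) t).hasDerivAt
      rw [h2.deriv]
      ring
    have h1 := hweak θ (by
        have : ContDiff ℝ 1 fun t : ℝ => Real.exp (l * t) := by fun_prop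
        exact this.mul (hφ.of_le (by simp)))
      ⟨T, fun t ht => by rw [hθ]; simp only; rw [hφ0 t fun h => absurd h.2 (not_lt.2 ht), mul_zero]⟩
      (by rw [hθ]; simp only; rw [hφ0 0 fun h => lt_irrefl _ h.1, mul_zero])
    have hres : ∀ f : ℝ → V, (∀ t ∉ Ioo 0 T, f t = 0) →
        ∫ t in Ioi 0, f t = ∫ t in Ioo 0 T, f t := fun f hf =>
      setIntegral_eq_of_subset_of_forall_sdiff_eq_zero measurableSet_Ioi
        Ioo_subset_Ioi_self fun t ht => hf t ht.2
    have hφm : MemLp φ 2 (timeMeasure T) := hφ.continuous.memLp_of_hasCompactSupport hφk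
    have hφdm : MemLp (deriv φ) 2 (timeMeasure T) := hφd.memLp_of_hasCompactSupport hφk.deriv
    have hPu : MemLp (fun t => pivotOp j (Real.exp (l * t) • v t)) 2 (timeMeasure T) :=
      (pivotOp j).comp_memLp' hu
    have hφPu : Integrable (fun t => l • φ t • pivotOp j (Real.exp (l * t) • v t))
        (timeMeasure T) := (hφm.integrable_smul_two hPu).smul l
    rw [hres _ fun t ht => by rw [hθd, hφ0 t ht, hφd0 t ht]; simp,
      hres _ fun t ht => by rw [hθ]; simp only; rw [hφ0 t ht]; simp] at h1
    have h2 : ∫ t in Ioo 0 T, deriv θ t • pivotOp j (v t)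
        = (∫ t in Ioo 0 T, deriv φ t • pivotOp j (Real.exp (l * t) • v t))
          + ∫ t in Ioo 0 T, l • φ t • pivotOp j (Real.exp (l * t) • v t) := by
      rw [← integral_add (hφdm.integrable_smul_two hPu) hφPu]
      refine integral_congr_ae (Eventually.of_forall fun t => ?_)
      simp only [hθd, map_smul, smul_smul, add_smul]
      congr 2 <;> ring
    have h3 : ∫ t in Ioo 0 T, θ t • N t (v t)
        = (∫ t in Ioo 0 T, φ t • n t (Real.exp (l * t) • v t))
          + ∫ t in Ioo 0 T, l • φ t • pivotOp j (Real.exp (l * t) • v t) := by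
      rw [← integral_add (hφm.integrable_smul_two hnu) hφPu]
      refine setIntegral_congr_fun measurableSet_Ioo fun t ht => ?_
      simp only [hNin ht, hθ, map_smul, smul_smul, smul_add]
      congr 2
      · linear_combination φ t * hexp t
      · ring
    rw [h2, h3] at h1
    rw [add_right_cancel h1, ← integral_neg]
    simp
  · filter_upwards [ae_mono hle hx] with t ht
    rw [ht, map_smul]

end BoundedInterval

/-! ### Uniqueness on a bounded time interval -/

section Uniqueness

open Filter Topology Dynamo

variable {V : Type*} [NormedAddCommGroup V] [InnerProductSpace ℝ V] [CompleteSpace V]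
variable {H : Type*} [NormedAddCommGroup H] [InnerProductSpace ℝ H] [CompleteSpace H]

/-- The energy identity on `(0, T)` for a function with zero initial value. -/
lemma norm_sq_eq_two_mul_integral {j : V →L[ℝ] H} {T : ℝ} (hT : 0 < T)
    {z g : ℝ → V} (hz : MemLp z 2 (timeMeasure T)) (hg : MemLp g 2 (timeMeasure T))
    (hzg : IsWeakTimeDeriv T (fun t => pivotOp j (z t)) g) {x : ℝ → H} (hxc : Continuous x)
    (hx0 : x 0 = 0) (hx : ∀ᵐ t ∂(timeMeasure T), x t = j (z t)) {b : ℝ} (hb : b ∈ Ico 0 T) :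
    ‖x b‖ ^ 2 = 2 * ∫ t in Ioo 0 b, inner ℝ (g t) (z t) := by
  have hfin : IsFiniteMeasure (timeMeasure T) := ⟨by simp⟩
  set U := (Ioo 0 T).indicator z with hUdef
  set G := (Ioo 0 T).indicator g with hGdef
  have hU : MemLp U 2 volume := (memLp_indicator_iff_restrict measurableSet_Ioo).2 hz
  have hG : MemLp G 2 volume := (memLp_indicator_iff_restrict measurableSet_Ioo).2 hg
  have hGg : ∀ t ∈ Icc 0 T, ∫ s in (0 : ℝ)..t, g s = ∫ s in (0 : ℝ)..t, G s := by
    intro t ht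
    rw [intervalIntegral.integral_of_le ht.1, intervalIntegral.integral_of_le ht.1,
      integral_Ioc_eq_integral_Ioo, integral_Ioc_eq_integral_Ioo]
    refine setIntegral_congr_fun measurableSet_Ioo fun s hs => ?_
    have hsT : s ∈ Ioo 0 T := ⟨hs.1, hs.2.trans_le ht.2⟩
    rw [hGdef, indicator_of_mem hsT]
  have hPz : MemLp (fun t => pivotOp j (z t)) 2 (timeMeasure T) := (pivotOp j).comp_memLp' hz
  obtain ⟨c, hc⟩ := hzg.exists_ae_eq_primitive hT (hPz.integrable (by norm_num))
    (hg.integrable (by norm_num))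
  have hprim : Continuous fun t => ∫ s in (0 : ℝ)..t, G s :=
    intervalIntegral.continuous_primitive hG.intervalIntegrable_two 0
  -- the initial value of the continuous representative fixes the constant of integration
  have hcont : ∀ A, ∀ t ∈ Icc 0 T, inner ℝ (x t) (j A) = inner ℝ (c + ∫ s in (0 : ℝ)..t, G s) A := by
    intro A
    refine Measure.eqOn_Icc_of_ae_eq (volume : Measure ℝ) hT.ne ?_ (by fun_prop)
      (Continuous.continuousOn ((continuous_const.add hprim).inner continuous_const))
    rw [← restrict_Ioo_eq_restrict_Icc]
    filter_upwards [hx, hc, ae_restrict_mem measurableSet_Ioo] with t h1 h2 h3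
    rw [h1, ← inner_pivotOp_left, h2, hGg t ⟨h3.1.le, h3.2.le⟩]
  have hc0 : c = 0 := by
    refine ext_inner_right ℝ fun A => ?_
    have := hcont A 0 ⟨le_rfl, hT.le⟩
    simpa [hx0] using this.symm
  have hUw : ∀ᵐ t, t < T → pivotOp j (U t) = ∫ s in (0 : ℝ)..t, G s := by
    have h1 := (ae_restrict_iff' measurableSet_Ioo).1 hc
    have h0 : ∀ᵐ t : ℝ, t ≠ 0 := by simp [ae_iff]
    filter_upwards [h1, h0] with t h2 h3 h4
    rcases lt_or_gt_of_ne h3 with h5 | h5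
    · have h6 : t ∉ Ioo 0 T := fun h => absurd h.1 (not_lt.2 h5.le)
      rw [hUdef, indicator_of_notMem h6, map_zero,
        intervalIntegral.integral_congr (g := fun _ => 0)]
      · simp
      · intro s hs
        rw [uIcc_of_ge h5.le] at hs
        exact indicator_of_notMem (fun h => absurd h.1 (not_lt.2 hs.2)) _
    · have h6 : t ∈ Ioo 0 T := ⟨h5, h4⟩
      rw [hUdef, indicator_of_mem h6, h2 h6, hc0, zero_add, hGg t ⟨h5.le, h4.le⟩]
  have hw : ∀ s t : ℝ, (∫ r in (0 : ℝ)..t, G r) - (∫ r in (0 : ℝ)..s, G r) = ∫ r in s..t, G r :=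
    fun s t => by
      rw [intervalIntegral.integral_interval_sub_left] <;> exact hG.intervalIntegrable_two _ _
  have hlim := tendsto_average_norm_sq j hU hG hw hb.2 hUw
  have hx2 : Continuous fun t => ‖x t‖ ^ 2 := by fun_prop
  have hderiv : HasDerivAt (fun t => ∫ s in b..t, ‖x s‖ ^ 2) (‖x b‖ ^ 2) b :=
    intervalIntegral.integral_hasDerivAt_right (hx2.intervalIntegrable _ _)
      (hx2.stronglyMeasurableAtFilter _ _) hx2.continuousAt
  have hlim' := hderiv.tendsto_slope_zero_right
  have heq : ∀ᶠ h : ℝ in 𝓝[>] 0, h⁻¹ • ((∫ s in b..(b + h), ‖x s‖ ^ 2) - ∫ s in b..b, ‖x s‖ ^ 2)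
      = h⁻¹ * ∫ t in Ioo b (b + h), ‖j (U t)‖ ^ 2 := by
    filter_upwards [Ioo_mem_nhdsGT (sub_pos.2 hb.2)] with h hh
    have hhp : 0 < h := hh.1
    rw [intervalIntegral.integral_same, sub_zero, smul_eq_mul,
      intervalIntegral.integral_of_le (by linarith), integral_Ioc_eq_integral_Ioo]
    congr 1
    refine setIntegral_congr_ae measurableSet_Ioo ?_
    filter_upwards [(ae_restrict_iff' measurableSet_Ioo).1 hx] with t ht htm
    have : t ∈ Ioo 0 T := ⟨hb.1.trans_lt htm.1, by linarith [htm.2, hh.2]⟩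
    rw [hUdef, indicator_of_mem this, ht this]
  rw [tendsto_nhds_unique (hlim'.congr' heq) hlim]
  congr 1
  have hset : ∀ t, inner ℝ (G t) (U t) = (Ioo 0 T).indicator (fun t => inner ℝ (g t) (z t)) t := by
    intro t
    by_cases ht : t ∈ Ioo 0 T
    · simp [hGdef, hUdef, ht]
    · simp [hGdef, hUdef, ht]
  simp only [hset]
  rw [setIntegral_indicator measurableSet_Ioo]
  congr 2
  ext t
  simp only [mem_inter_iff, mem_Iio, mem_Ioo]
  exact ⟨fun h => ⟨h.2.1, h.1⟩, fun h => ⟨h.2, h.1, h.2.trans hb.2⟩⟩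

/-- A function on `(0, T)` with zero initial value whose energy production satisfies a Gårding
bound vanishes: Gronwall's lemma applies to `b ↦ ∫_0^b |x|²`. -/
theorem ae_eq_zero_of_garding {j : V →L[ℝ] H} {T : ℝ} (hT : 0 < T)
    {z g : ℝ → V} {m l : ℝ} (hm : 0 < m) (hz : MemLp z 2 (timeMeasure T))
    (hg : MemLp g 2 (timeMeasure T))
    (hzg : IsWeakTimeDeriv T (fun t => pivotOp j (z t)) g) {x : ℝ → H}
    (hxc : ContinuousOn x (Icc 0 T)) (hx0 : x 0 = 0)
    (hx : ∀ᵐ t ∂(timeMeasure T), x t = j (z t))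
    (hbound : ∀ᵐ t ∂(timeMeasure T),
      inner ℝ (g t) (z t) ≤ l * ‖j (z t)‖ ^ 2 - m * ‖z t‖ ^ 2) :
    ∀ᵐ t ∂(timeMeasure T), z t = 0 := by
  -- extend `x` to the line by its boundary values
  wlog hxcont : Continuous x generalizing x
  · refine this (x := IccExtend hT.le ((Icc 0 T).domRestrict x)) ?_ ?_ ?_ ?_
    · exact (hxc.domRestrict.Icc_extend' (h := hT.le)).continuousOn
    · rw [IccExtend_of_mem _ _ ⟨le_rfl, hT.le⟩]; exact hx0
    · filter_upwards [hx, ae_restrict_mem measurableSet_Ioo] with t h1 h2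
      rw [IccExtend_of_mem _ _ (Ioo_subset_Icc_self h2)]; exact h1
    · exact hxc.domRestrict.Icc_extend' (h := hT.le)
  have hsub : ∀ {b}, b ∈ Ico 0 T → Ioo 0 b ⊆ Ioo 0 T := fun hb => Ioo_subset_Ioo_right hb.2.le
  have hzi : IntegrableOn (fun t => ‖z t‖ ^ 2) (Ioo 0 T) := hz.norm.integrable_sq
  have hji : IntegrableOn (fun t => ‖j (z t)‖ ^ 2) (Ioo 0 T) :=
    (j.comp_memLp' hz).norm.integrable_sq
  have henergy : ∀ b ∈ Ico 0 T,
      ‖x b‖ ^ 2 ≤ 2 * (l * ∫ t in (0 : ℝ)..b, ‖x t‖ ^ 2) - 2 * (m * ∫ t in Ioo 0 b, ‖z t‖ ^ 2) := by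
    intro b hb
    rw [norm_sq_eq_two_mul_integral hT hz hg hzg hxcont hx0 hx hb, ← mul_sub]
    refine mul_le_mul_of_nonneg_left ?_ two_pos.le
    have h1 : ∫ t in (0 : ℝ)..b, ‖x t‖ ^ 2 = ∫ t in Ioo 0 b, ‖j (z t)‖ ^ 2 := by
      rw [intervalIntegral.integral_of_le hb.1, integral_Ioc_eq_integral_Ioo]
      refine integral_congr_ae ?_
      filter_upwards [ae_restrict_of_ae_restrict_of_subset (hsub hb) hx] with t ht
      rw [ht]
    rw [h1, ← integral_const_mul, ← integral_const_mul, ← integral_sub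
      ((hji.mono_set (hsub hb)).const_mul l) ((hzi.mono_set (hsub hb)).const_mul m)]
    refine integral_mono_ae (IntegrableOn.mono_set (hg.integrable_inner' hz) (hsub hb))
      (((hji.mono_set (hsub hb)).const_mul l).sub ((hzi.mono_set (hsub hb)).const_mul m)) ?_
    exact ae_restrict_of_ae_restrict_of_subset (hsub hb) hbound
  have hx2 : Continuous fun t => ‖x t‖ ^ 2 := by fun_prop
  have hderiv : ∀ b, HasDerivAt (fun t => ∫ s in (0 : ℝ)..t, ‖x s‖ ^ 2) (‖x b‖ ^ 2) b := fun b =>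
    intervalIntegral.integral_hasDerivAt_right (hx2.intervalIntegrable _ _)
      (hx2.stronglyMeasurableAtFilter _ _) hx2.continuousAt
  have hgr := norm_le_gronwallBound_of_norm_deriv_right_le (δ := 0) (K := 2 * |l|) (ε := 0)
    (f := fun t => ∫ s in (0 : ℝ)..t, ‖x s‖ ^ 2) (f' := fun b => ‖x b‖ ^ 2) (a := 0) (b := T)
    (fun b _ => (hderiv b).continuousAt.continuousWithinAt)
    (fun b _ => (hderiv b).hasDerivWithinAt) (by simp) (by
      intro b hb
      have h1 := henergy b hb
      have h2 : 0 ≤ m * ∫ t in Ioo 0 b, ‖z t‖ ^ 2 :=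
        mul_nonneg hm.le (integral_nonneg fun t => by positivity)
      have h3 : 0 ≤ ∫ t in (0 : ℝ)..b, ‖x t‖ ^ 2 :=
        intervalIntegral.integral_nonneg hb.1 fun t _ => by positivity
      rw [Real.norm_of_nonneg (by positivity), Real.norm_of_nonneg h3]
      have := mul_le_mul_of_nonneg_right (le_abs_self l) h3
      linarith)
  have hΦ : ∀ b ∈ Ico 0 T, ∫ t in (0 : ℝ)..b, ‖x t‖ ^ 2 = 0 := by
    intro b hb
    have := hgr b ⟨hb.1, hb.2.le⟩
    rw [gronwallBound_ε0_δ0] at this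
    exact norm_le_zero_iff.1 this
  have hz0 : ∀ b ∈ Ico 0 T, ∫ t in Ioo 0 b, ‖z t‖ ^ 2 = 0 := by
    intro b hb
    have h1 := henergy b hb
    rw [hΦ b hb] at h1
    have h2 : 0 ≤ ∫ t in Ioo 0 b, ‖z t‖ ^ 2 := integral_nonneg fun t => by positivity
    have h3 := sq_nonneg ‖x b‖
    nlinarith
  -- the primitive of `|z|²` is continuous, so that it also vanishes at time `T`
  have hzI : IntervalIntegrable (fun t => ‖z t‖ ^ 2) volume 0 T :=
    (intervalIntegrable_iff_integrableOn_Ioo_of_le hT.le).2 hzi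
  have hF : ContinuousOn (fun b => ∫ t in (0 : ℝ)..b, ‖z t‖ ^ 2) (Icc 0 T) := by
    have := intervalIntegral.continuousOn_primitive_interval' hzI (a := 0) (by simp)
    rwa [uIcc_of_le hT.le] at this
  have hFT : ∫ t in (0 : ℝ)..T, ‖z t‖ ^ 2 = 0 := by
    have h1 : EqOn (fun b => ∫ t in (0 : ℝ)..b, ‖z t‖ ^ 2) (fun _ => 0) (Icc 0 T) := by
      refine EqOn.of_subset_closure (s := Ico 0 T) (fun b hb => ?_) hF continuousOn_const
        Ico_subset_Icc_self (by rw [closure_Ico hT.ne])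
      rw [intervalIntegral.integral_of_le hb.1, integral_Ioc_eq_integral_Ioo]
      exact hz0 b hb
    exact h1 ⟨hT.le, le_rfl⟩
  rw [intervalIntegral.integral_of_le hT.le, integral_Ioc_eq_integral_Ioo,
    setIntegral_eq_zero_iff_of_nonneg_ae (Eventually.of_forall fun t => by positivity) hzi] at hFT
  filter_upwards [hFT] with t ht
  simpa using ht

end Uniqueness

/-! ### The space `H₀(curl; Ω)` -/

section CurlSpace

open Filter Topology

namespace Dynamo

lemma continuous_integral_inner_test {Ω : Set E3} {ψ : E3 → E3} (hc : Continuous ψ)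
    (hs : HasCompactSupport ψ) :
    Continuous fun A : L2 Ω => ∫ x in Ω, inner ℝ (A x) (ψ x) := by
  have hψ : MemLp ψ 2 (volume.restrict Ω) := hc.memLp_of_hasCompactSupport hs
  have h : (fun A : L2 Ω => ∫ x in Ω, inner ℝ (A x) (ψ x))
      = fun A => inner ℝ A hψ.toLp := by
    funext A
    rw [L2.inner_def]
    refine integral_congr_ae ?_
    filter_upwards [hψ.coeFn_toLp] with x hx
    rw [hx]
  rw [h]
  fun_prop

lemma isClosed_H0curlSubmodule (Ω : Set E3) :
    IsClosed (H0curlSubmodule Ω : Set (WithLp 2 (L2 Ω × L2 Ω))) := by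
  have hfst : Continuous fun p : WithLp 2 (L2 Ω × L2 Ω) => p.fst :=
    (WithLp.fstL 2 ℝ (L2 Ω) (L2 Ω)).continuous
  have hsnd : Continuous fun p : WithLp 2 (L2 Ω × L2 Ω) => p.snd :=
    (WithLp.sndL 2 ℝ (L2 Ω) (L2 Ω)).continuous
  have h : (H0curlSubmodule Ω : Set (WithLp 2 (L2 Ω × L2 Ω)))
      = {p | HasWeakCurl Ω p.fst p.snd} ∩ {p | HasZeroTangentialTrace Ω p.fst p.snd} := rfl
  rw [h]
  refine IsClosed.inter ?_ ?_
  · simp only [HasWeakCurl, ofPred_forall]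
    refine isClosed_iInter fun φ => isClosed_iInter fun h1 => isClosed_iInter fun h2 =>
      isClosed_iInter fun _ => isClosed_eq ?_ ?_
    · exact (continuous_integral_inner_test h1.continuous h2).comp hsnd
    · exact (continuous_integral_inner_test (continuous_classicalCurl h1)
        (hasCompactSupport_classicalCurl h2)).comp hfst
  · simp only [HasZeroTangentialTrace, ofPred_forall]
    refine isClosed_iInter fun φ => isClosed_iInter fun h1 => isClosed_iInter fun h2 =>
      isClosed_eq (Continuous.sub ?_ ?_) continuous_const
    · exact (continuous_integral_inner_test h1.continuous h2).comp hsnd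
    · exact (continuous_integral_inner_test (continuous_classicalCurl h1)
        (hasCompactSupport_classicalCurl h2)).comp hfst

instance (Ω : Set E3) : CompleteSpace (V Ω) :=
  (isClosed_H0curlSubmodule Ω).completeSpace_coe

lemma norm_sq_eq_field_add_curl {Ω : Set E3} (v : V Ω) :
    ‖v‖ ^ 2 = ‖field Ω v‖ ^ 2 + ‖curl Ω v‖ ^ 2 := by
  rw [← Submodule.norm_coe, WithLp.prod_norm_sq_eq_of_L2]
  rfl

lemma norm_field_le {Ω : Set E3} (v : V Ω) : ‖field Ω v‖ ≤ ‖v‖ := by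
  refine (sq_le_sq₀ (norm_nonneg _) (norm_nonneg _)).1 ?_
  nlinarith [norm_sq_eq_field_add_curl v, sq_nonneg ‖curl Ω v‖]

lemma norm_curl_le {Ω : Set E3} (v : V Ω) : ‖curl Ω v‖ ≤ ‖v‖ := by
  refine (sq_le_sq₀ (norm_nonneg _) (norm_nonneg _)).1 ?_
  nlinarith [norm_sq_eq_field_add_curl v, sq_nonneg ‖field Ω v‖]

/-! ### Density of test fields -/

lemma fderiv_component {φ : E3 → E3} (hφ : ContDiff ℝ ∞ φ) (j k : Fin 3) (x : E3) :
    fderiv ℝ (fun y => φ y k) x (EuclideanSpace.single j 1) = partialD φ j k x := by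
  have h := (hφ.differentiable (by simp) x).hasFDerivAt
  have h2 : HasFDerivAt (fun y => φ y k)
      ((EuclideanSpace.proj k : E3 →L[ℝ] ℝ).comp (fderiv ℝ φ x)) x :=
    (EuclideanSpace.proj k : E3 →L[ℝ] ℝ).hasFDerivAt.comp x h
  rw [h2.fderiv]
  rfl

lemma continuous_component {φ : E3 → E3} (hφ : Continuous φ) (k : Fin 3) :
    Continuous fun y => φ y k :=
  (EuclideanSpace.proj k : E3 →L[ℝ] ℝ).continuous.comp hφ

lemma hasCompactSupport_component {φ : E3 → E3} (hφ : HasCompactSupport φ) (k : Fin 3) :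
    HasCompactSupport fun y => φ y k :=
  hφ.comp_left (g := fun v : E3 => v k) rfl

lemma integral_component_mul_partialD {φ ψ : E3 → E3} (hφ : ContDiff ℝ ∞ φ)
    (hφc : HasCompactSupport φ) (hψ : ContDiff ℝ ∞ ψ) (j k l : Fin 3) :
    ∫ x, φ x k * partialD ψ j l x = - ∫ x, partialD φ j k x * ψ x l := by
  have hc : HasCompactSupport fun x => partialD φ j k x := by
    refine (hφc.fderiv (𝕜 := ℝ)).mono fun x hx => ?_
    rw [Function.mem_support] at hx ⊢
    intro h0
    simp [partialD, h0] at hx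
  have hφk := continuous_component hφ.continuous k
  have hψl := continuous_component hψ.continuous l
  have hck := hasCompactSupport_component hφc k
  have hdk : Differentiable ℝ fun y => φ y k := fun x =>
    ((EuclideanSpace.proj k : E3 →L[ℝ] ℝ).differentiableAt).comp x (hφ.differentiable (by simp) x)
  have hdl : Differentiable ℝ fun y => ψ y l := fun x =>
    ((EuclideanSpace.proj l : E3 →L[ℝ] ℝ).differentiableAt).comp x (hψ.differentiable (by simp) x)
  have h := integral_mul_fderiv_eq_neg_fderiv_mul_of_integrable (μ := (volume : Measure E3))
    (f := fun y => φ y k) (g := fun y => ψ y l) (v := EuclideanSpace.single j 1) ?_ ?_ ?_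
    (fun x _ => hdk x) (fun x _ => hdl x)
  · simpa only [fderiv_component hφ, fderiv_component hψ] using h
  · simp only [fderiv_component hφ]
    exact ((continuous_partialD hφ j k).mul hψl).integrable_of_hasCompactSupport hc.mul_right
  · simp only [fderiv_component hψ]
    exact (hφk.mul (continuous_partialD hψ j l)).integrable_of_hasCompactSupport hck.mul_right
  · exact (hφk.mul hψl).integrable_of_hasCompactSupport hck.mul_right

lemma inner_eq_sum (a b : E3) : inner ℝ a b = a 0 * b 0 + a 1 * b 1 + a 2 * b 2 := by
  simp [PiLp.inner_apply, Fin.sum_univ_three, mul_comm]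

lemma integral_sub_add_sub_add_sub {a b c d e f : E3 → ℝ} (ha : Integrable a)
    (hb : Integrable b) (hc : Integrable c) (hd : Integrable d) (he : Integrable e)
    (hf : Integrable f) :
    ∫ x, ((a x - b x) + (c x - d x) + (e x - f x))
      = ((∫ x, a x) - ∫ x, b x) + ((∫ x, c x) - ∫ x, d x) + ((∫ x, e x) - ∫ x, f x) := by
  have h1 : Integrable fun x => a x - b x := ha.sub hb
  have h2 : Integrable fun x => c x - d x := hc.sub hd
  have h3 : Integrable fun x => e x - f x := he.sub hf
  have h4 : Integrable fun x => (a x - b x) + (c x - d x) := h1.add h2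
  rw [integral_add h4 h3, integral_add h1 h2, integral_sub ha hb, integral_sub hc hd,
    integral_sub he hf]

/-- The curl is formally symmetric: no boundary term arises when one field has compact support. -/
lemma integral_inner_classicalCurl {φ ψ : E3 → E3} (hφ : ContDiff ℝ ∞ φ)
    (hφc : HasCompactSupport φ) (hψ : ContDiff ℝ ∞ ψ) :
    ∫ x, inner ℝ (classicalCurl φ x) (ψ x) = ∫ x, inner ℝ (φ x) (classicalCurl ψ x) := by
  have i1 : ∀ j k l, Integrable fun x => partialD φ j k x * ψ x l := fun j k l => by
    refine ((continuous_partialD hφ j k).mul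
      (continuous_component hψ.continuous l)).integrable_of_hasCompactSupport
      (HasCompactSupport.mul_right ?_)
    refine (hφc.fderiv (𝕜 := ℝ)).mono fun x hx => ?_
    rw [Function.mem_support] at hx ⊢
    intro h0
    simp [partialD, h0] at hx
  have i2 : ∀ j k l, Integrable fun x => φ x k * partialD ψ j l x := fun j k l =>
    ((continuous_component hφ.continuous k).mul
      (continuous_partialD hψ j l)).integrable_of_hasCompactSupport
      (hasCompactSupport_component hφc k).mul_right
  have e1 : ∀ x, inner ℝ (classicalCurl φ x) (ψ x)
      = (partialD φ 1 2 x * ψ x 0 - partialD φ 2 1 x * ψ x 0)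
        + (partialD φ 2 0 x * ψ x 1 - partialD φ 0 2 x * ψ x 1)
        + (partialD φ 0 1 x * ψ x 2 - partialD φ 1 0 x * ψ x 2) := fun x => by
    rw [inner_eq_sum]; simp [classicalCurl]; ring
  have e2 : ∀ x, inner ℝ (φ x) (classicalCurl ψ x)
      = (φ x 0 * partialD ψ 1 2 x - φ x 0 * partialD ψ 2 1 x)
        + (φ x 1 * partialD ψ 2 0 x - φ x 1 * partialD ψ 0 2 x)
        + (φ x 2 * partialD ψ 0 1 x - φ x 2 * partialD ψ 1 0 x) := fun x => by
    rw [inner_eq_sum]; simp [classicalCurl]; ring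
  simp only [e1, e2]
  rw [integral_sub_add_sub_add_sub (i1 _ _ _) (i1 _ _ _) (i1 _ _ _) (i1 _ _ _) (i1 _ _ _)
      (i1 _ _ _),
    integral_sub_add_sub_add_sub (i2 _ _ _) (i2 _ _ _) (i2 _ _ _) (i2 _ _ _) (i2 _ _ _)
      (i2 _ _ _)]
  simp only [integral_component_mul_partialD hφ hφc hψ]
  ring

lemma tsupport_classicalCurl_subset (φ : E3 → E3) : tsupport (classicalCurl φ) ⊆ tsupport φ := by
  refine Subset.trans (closure_mono fun x hx => ?_) (closure_minimal (support_fderiv_subset ℝ)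
    (isClosed_tsupport φ))
  rw [Function.mem_support] at hx ⊢
  intro h0
  apply hx
  ext i
  fin_cases i <;> simp [classicalCurl, partialD, h0]

/-- Smooth fields with compact support in `Ω` belong to `H₀(curl; Ω)`. -/
lemma exists_field_eq_test {Ω : Set E3} {φ : E3 → E3} (hφ : ContDiff ℝ ∞ φ)
    (hφc : HasCompactSupport φ) (hφΩ : tsupport φ ⊆ Ω) :
    ∃ v : V Ω, field Ω v =ᵐ[volume.restrict Ω] φ := by
  have m1 : MemLp φ 2 (volume.restrict Ω) := hφ.continuous.memLp_of_hasCompactSupport hφc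
  have m2 : MemLp (classicalCurl φ) 2 (volume.restrict Ω) :=
    (continuous_classicalCurl hφ).memLp_of_hasCompactSupport (hasCompactSupport_classicalCurl hφc)
  have key : ∀ ψ : E3 → E3, ContDiff ℝ ∞ ψ → HasCompactSupport ψ →
      ∫ x in Ω, inner ℝ (m2.toLp _ x) (ψ x) = ∫ x in Ω, inner ℝ (m1.toLp _ x) (classicalCurl ψ x) := by
    intro ψ hψ _
    have a1 : ∫ x in Ω, inner ℝ (m2.toLp _ x) (ψ x) = ∫ x in Ω, inner ℝ (classicalCurl φ x) (ψ x) :=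
      integral_congr_ae (by filter_upwards [m2.coeFn_toLp] with x hx; rw [hx])
    have a2 : ∫ x in Ω, inner ℝ (m1.toLp _ x) (classicalCurl ψ x)
        = ∫ x in Ω, inner ℝ (φ x) (classicalCurl ψ x) :=
      integral_congr_ae (by filter_upwards [m1.coeFn_toLp] with x hx; rw [hx])
    rw [a1, a2, setIntegral_eq_integral_of_forall_compl_eq_zero,
      setIntegral_eq_integral_of_forall_compl_eq_zero, integral_inner_classicalCurl hφ hφc hψ]
    · intro x hx
      rw [image_eq_zero_of_notMem_tsupport fun h => hx (hφΩ h), inner_zero_left]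
    · intro x hx
      rw [image_eq_zero_of_notMem_tsupport
        fun h => hx (hφΩ (tsupport_classicalCurl_subset φ h)), inner_zero_left]
  refine ⟨⟨WithLp.toLp 2 (m1.toLp, m2.toLp), fun ψ h1 h2 _ => key ψ h1 h2,
    fun ψ h1 h2 => sub_eq_zero.2 (key ψ h1 h2)⟩, m1.coeFn_toLp⟩

lemma denseRange_field {Ω : Set E3} (hΩ : IsOpen Ω) : DenseRange (field Ω) := by
  have hrange : DenseRange (field Ω) ↔ Dense ((field Ω).range : Set (L2 Ω)) := by
    rw [DenseRange]; rfl
  rw [hrange, Submodule.dense_iff_topologicalClosure_eq_top,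
    Submodule.topologicalClosure_eq_top_iff, Submodule.eq_bot_iff]
  intro h hh
  have horth : ∀ v : V Ω, inner ℝ h (field Ω v) = 0 := fun v => by
    rw [real_inner_comm]
    exact (Submodule.mem_orthogonal _ h).1 hh _ ⟨v, rfl⟩
  have hloc : LocallyIntegrableOn (h : E3 → E3) Ω volume := by
    refine (locallyIntegrableOn_iff hΩ.isLocallyClosed).2 fun K hK hKc => ?_
    have hm : MemLp (h : E3 → E3) 2 (volume.restrict K) :=
      (Lp.memLp h).mono_measure (Measure.restrict_mono hK le_rfl)
    have : IsFiniteMeasure (volume.restrict K) := ⟨by simpa using hKc.measure_lt_top⟩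
    exact hm.integrable one_le_two
  have h0 := hΩ.ae_eq_zero_of_integral_contDiff_smul_eq_zero hloc (fun g g1 g2 g3 => by
    have hint : Integrable (fun x => g x • h x) (volume.restrict Ω) := by
      have hg : MemLp g 2 (volume.restrict Ω) := g1.continuous.memLp_of_hasCompactSupport g2
      exact MemLp.integrable_smul_two hg (Lp.memLp h)
    rw [← setIntegral_eq_integral_of_forall_compl_eq_zero (s := Ω) (fun x hx => by
      rw [image_eq_zero_of_notMem_tsupport fun h => hx (g3 h), zero_smul])]
    refine ext_inner_right ℝ fun e => ?_
    rw [inner_zero_left, real_inner_comm, ← integral_inner hint]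
    have hφ : ContDiff ℝ ∞ fun x => g x • e := g1.smul contDiff_const
    have hs : tsupport (fun x => g x • e) ⊆ tsupport g :=
      closure_mono (Function.support_smul_subset_left g _)
    obtain ⟨v, hv⟩ := exists_field_eq_test (Ω := Ω) hφ g2.smul_right (hs.trans g3)
    rw [← horth v, L2.inner_def]
    refine integral_congr_ae ?_
    filter_upwards [hv] with x hx
    rw [hx, real_inner_smul_right, real_inner_smul_right, real_inner_comm])
  refine (Lp.eq_zero_iff_ae_eq_zero).2 ?_
  exact (ae_restrict_iff' hΩ.measurableSet).2 h0

end Dynamo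

end CurlSpace

/-! ### The coefficients -/

section Coefficients

open Filter Topology

namespace Dynamo

/-- The vector product as a continuous bilinear map. -/
noncomputable def crossL : E3 →L[ℝ] E3 →L[ℝ] E3 :=
  (LinearMap.mk₂ ℝ cross
    (fun a b c => by simp [cross]) (fun r a b => by simp [cross])
    (fun a b c => by simp [cross]) (fun r a b => by simp [cross])).toContinuousBilinearMap

/-- The `α`-quenching nonlinearity `y ↦ y / (1 + σ|y|²)`. -/
noncomputable def quench (σ : ℝ) (y : E3) : E3 := (1 / (1 + σ * ‖y‖ ^ 2)) • y

lemma quench_zero (σ : ℝ) : quench σ 0 = 0 := by simp [quench]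

lemma lipschitzWith_quench {σ : ℝ} (hσ : 0 ≤ σ) : LipschitzWith 3 (quench σ) := by
  refine LipschitzWith.of_dist_le_mul fun x y => ?_
  rw [dist_eq_norm, dist_eq_norm]
  have ha : 0 < 1 + σ * ‖x‖ ^ 2 := by positivity
  have hb : 0 < 1 + σ * ‖y‖ ^ 2 := by positivity
  set a := 1 + σ * ‖x‖ ^ 2 with ha'
  set b := 1 + σ * ‖y‖ ^ 2 with hb'
  have hsplit : quench σ x - quench σ y
      = (1 / a) • (x - y) + (σ * (‖y‖ ^ 2 - ‖x‖ ^ 2) / (a * b)) • y := by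
    have h : σ * (‖y‖ ^ 2 - ‖x‖ ^ 2) / (a * b) = 1 / a - 1 / b := by
      field_simp
      rw [ha', hb']; ring
    rw [h, quench, quench, ← ha', ← hb', smul_sub, sub_smul]
    abel
  have h1 : ‖(1 / a) • (x - y)‖ ≤ 1 * ‖x - y‖ := by
    rw [norm_smul, Real.norm_of_nonneg (by positivity)]
    gcongr
    rw [div_le_one ha, ha']
    have : 0 ≤ σ * ‖x‖ ^ 2 := by positivity
    linarith
  have h2 : ‖(σ * (‖y‖ ^ 2 - ‖x‖ ^ 2) / (a * b)) • y‖ ≤ 2 * ‖x - y‖ := by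
    rw [norm_smul, norm_div, norm_mul, Real.norm_of_nonneg hσ,
      Real.norm_of_nonneg (by positivity : 0 ≤ a * b), div_mul_eq_mul_div,
      div_le_iff₀ (by positivity)]
    have hd : ‖‖y‖ ^ 2 - ‖x‖ ^ 2‖ ≤ ‖x - y‖ * (‖x‖ + ‖y‖) := by
      rw [show ‖y‖ ^ 2 - ‖x‖ ^ 2 = (‖y‖ - ‖x‖) * (‖x‖ + ‖y‖) by ring, norm_mul,
        Real.norm_of_nonneg (by positivity : 0 ≤ ‖x‖ + ‖y‖)]
      gcongr
      rw [Real.norm_eq_abs, norm_sub_rev]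
      exact abs_norm_sub_norm_le y x
    have hab : σ * (‖x‖ + ‖y‖) * ‖y‖ ≤ 2 * (a * b) := by
      have : σ * ‖x‖ * ‖y‖ ≤ σ * ‖x‖ ^ 2 + σ * ‖y‖ ^ 2 := by
        have := mul_le_mul_of_nonneg_left (two_mul_le_add_sq ‖x‖ ‖y‖) hσ
        have h0 : 0 ≤ σ * (‖x‖ * ‖y‖) := by positivity
        nlinarith
      have h0 : 0 ≤ σ * ‖x‖ ^ 2 * (σ * ‖y‖ ^ 2) := by positivity
      have h3 : 0 ≤ σ * ‖x‖ ^ 2 := by positivity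
      rw [ha', hb']
      nlinarith
    calc σ * ‖‖y‖ ^ 2 - ‖x‖ ^ 2‖ * ‖y‖ ≤ σ * (‖x - y‖ * (‖x‖ + ‖y‖)) * ‖y‖ := by gcongr
      _ = ‖x - y‖ * (σ * (‖x‖ + ‖y‖) * ‖y‖) := by ring
      _ ≤ ‖x - y‖ * (2 * (a * b)) := by gcongr
      _ = 2 * ‖x - y‖ * (a * b) := by ring
  rw [hsplit]
  refine (norm_add_le _ _).trans ((add_le_add h1 h2).trans_eq ?_)
  rw [NNReal.coe_ofNat]
  ring

/-- Pointwise multiplication by bounded scalar functions, `L^∞ × L² → L²`. -/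
noncomputable def mulL (Ω : Set E3) : Lp ℝ ⊤ (volume.restrict Ω) →L[ℝ] L2 Ω →L[ℝ] L2 Ω :=
  (ContinuousLinearMap.lsmul ℝ ℝ : ℝ →L[ℝ] E3 →L[ℝ] E3).holderL (volume.restrict Ω) ⊤ 2 2

lemma coeFn_mulL {Ω : Set E3} (f : Lp ℝ ⊤ (volume.restrict Ω)) (b : L2 Ω) :
    mulL Ω f b =ᵐ[volume.restrict Ω] fun x => f x • b x :=
  ContinuousLinearMap.coeFn_holder (r := 2) (ContinuousLinearMap.lsmul ℝ ℝ) f b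

/-- Pointwise vector product with bounded fields, `L^∞ × L² → L²`. -/
noncomputable def crossLpL (Ω : Set E3) : Lp E3 ⊤ (volume.restrict Ω) →L[ℝ] L2 Ω →L[ℝ] L2 Ω :=
  crossL.holderL (volume.restrict Ω) ⊤ 2 2

lemma coeFn_crossLpL {Ω : Set E3} (u : Lp E3 ⊤ (volume.restrict Ω)) (b : L2 Ω) :
    crossLpL Ω u b =ᵐ[volume.restrict Ω] fun x => cross (u x) (b x) :=
  ContinuousLinearMap.coeFn_holder (r := 2) crossL u b

/-- The electromotive force `R_α f b / (1 + σ|b|²) + R_m u × b` as an element of `L²(Ω)³`. -/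
noncomputable def emf (Ω : Set E3) (Rα Rm : ℝ) {σ : ℝ} (hσ : 0 ≤ σ) (f : Lp ℝ ⊤ (volume.restrict Ω))
    (u : Lp E3 ⊤ (volume.restrict Ω)) (b : L2 Ω) : L2 Ω :=
  Rα • mulL Ω f ((lipschitzWith_quench hσ).compLp (quench_zero σ) b) + Rm • crossLpL Ω u b

lemma emf_zero {Ω : Set E3} (Rα Rm : ℝ) {σ : ℝ} (hσ : 0 ≤ σ) (f : Lp ℝ ⊤ (volume.restrict Ω))
    (u : Lp E3 ⊤ (volume.restrict Ω)) : emf Ω Rα Rm hσ f u 0 = 0 := by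
  simp [emf]

lemma continuous_emf {Ω : Set E3} (Rα Rm : ℝ) {σ : ℝ} (hσ : 0 ≤ σ) :
    Continuous fun p : (Lp ℝ ⊤ (volume.restrict Ω) × Lp E3 ⊤ (volume.restrict Ω)) × L2 Ω =>
      emf Ω Rα Rm hσ p.1.1 p.1.2 p.2 := by
  have hq := LipschitzWith.continuous_compLp (p := 2) (μ := volume.restrict Ω)
    (lipschitzWith_quench hσ) (quench_zero σ)
  unfold emf
  have h1 : Continuous fun p : (Lp ℝ ⊤ (volume.restrict Ω) × Lp E3 ⊤ (volume.restrict Ω)) × L2 Ω =>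
      mulL Ω p.1.1 ((lipschitzWith_quench hσ).compLp (quench_zero σ) p.2) :=
    ((mulL Ω).continuous.comp continuous_fst.fst).clm_apply (hq.comp continuous_snd)
  have h2 : Continuous fun p : (Lp ℝ ⊤ (volume.restrict Ω) × Lp E3 ⊤ (volume.restrict Ω)) × L2 Ω =>
      crossLpL Ω p.1.2 p.2 :=
    ((crossLpL Ω).continuous.comp continuous_fst.snd).clm_apply continuous_snd
  exact (h1.const_smul Rα).add (h2.const_smul Rm)

lemma norm_emf_sub_le {Ω : Set E3} (Rα Rm : ℝ) {σ : ℝ} (hσ : 0 ≤ σ)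
    {f : Lp ℝ ⊤ (volume.restrict Ω)} {u : Lp E3 ⊤ (volume.restrict Ω)} {Cf Cu : ℝ}
    (hf : ‖f‖ ≤ Cf) (hu : ‖u‖ ≤ Cu) (b b' : L2 Ω) :
    ‖emf Ω Rα Rm hσ f u b - emf Ω Rα Rm hσ f u b'‖
      ≤ (|Rα| * (‖mulL Ω‖ * Cf * 3) + |Rm| * (‖crossLpL Ω‖ * Cu)) * ‖b - b'‖ := by
  set Q : L2 Ω → L2 Ω := (lipschitzWith_quench hσ).compLp (quench_zero σ)
  have hQ : ‖Q b - Q b'‖ ≤ 3 * ‖b - b'‖ :=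
    LipschitzWith.norm_compLp_sub_le (lipschitzWith_quench hσ) (quench_zero σ) b b'
  have hsplit : emf Ω Rα Rm hσ f u b - emf Ω Rα Rm hσ f u b'
      = Rα • mulL Ω f (Q b - Q b') + Rm • crossLpL Ω u (b - b') := by
    simp only [emf, map_sub, smul_sub]
    abel
  have hCf : 0 ≤ Cf := (norm_nonneg f).trans hf
  have h1 : ‖mulL Ω f (Q b - Q b')‖ ≤ ‖mulL Ω‖ * Cf * (3 * ‖b - b'‖) :=
    ((mulL Ω).le_opNorm₂ _ _).trans (by gcongr)
  have h2 : ‖crossLpL Ω u (b - b')‖ ≤ ‖crossLpL Ω‖ * Cu * ‖b - b'‖ :=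
    ((crossLpL Ω).le_opNorm₂ _ _).trans (by gcongr)
  rw [hsplit]
  refine (norm_add_le _ _).trans ?_
  rw [norm_smul, norm_smul, Real.norm_eq_abs, Real.norm_eq_abs]
  calc |Rα| * ‖mulL Ω f (Q b - Q b')‖ + |Rm| * ‖crossLpL Ω u (b - b')‖
      ≤ |Rα| * (‖mulL Ω‖ * Cf * (3 * ‖b - b'‖)) + |Rm| * (‖crossLpL Ω‖ * Cu * ‖b - b'‖) := by
        gcongr
    _ = _ := by ring

lemma source_eq_inner_emf {Ω : Set E3} (Rα Rm : ℝ) {σ : ℝ} (hσ : 0 ≤ σ)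
    (f : Lp ℝ ⊤ (volume.restrict Ω)) (u : Lp E3 ⊤ (volume.restrict Ω)) (B A : V Ω) :
    source Ω Rα Rm σ f u B A = inner ℝ (emf Ω Rα Rm hσ f u (field Ω B)) (curl Ω A) := by
  rw [source, emf, inner_add_left, real_inner_smul_left, real_inner_smul_left, L2.inner_def,
    L2.inner_def]
  congr 2
  · refine integral_congr_ae ?_
    filter_upwards [coeFn_mulL f ((lipschitzWith_quench hσ).compLp (quench_zero σ) (field Ω B)),
      (lipschitzWith_quench hσ).coeFn_compLp (quench_zero σ) (field Ω B)] with x h1 h2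
    rw [h1, h2, Function.comp_apply, quench, smul_smul, mul_one_div]
  · refine integral_congr_ae ?_
    filter_upwards [coeFn_crossLpL u (field Ω B)] with x h1
    rw [h1]

lemma inner_mulL {Ω : Set E3} {β : E3 → ℝ} (hβ : MemLp β ⊤ (volume.restrict Ω)) (C D : L2 Ω) :
    inner ℝ (mulL Ω hβ.toLp C) D = ∫ x in Ω, β x * inner ℝ (C x) (D x) := by
  rw [L2.inner_def]
  refine integral_congr_ae ?_
  filter_upwards [coeFn_mulL hβ.toLp C, hβ.coeFn_toLp] with x h1 h2
  rw [h1, h2, real_inner_smul_left]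

lemma le_inner_mulL {Ω : Set E3} {β : E3 → ℝ} (hβ : MemLp β ⊤ (volume.restrict Ω)) {β₀ : ℝ}
    (h0 : ∀ᵐ x ∂volume.restrict Ω, β₀ ≤ β x) (C : L2 Ω) :
    β₀ * ‖C‖ ^ 2 ≤ inner ℝ (mulL Ω hβ.toLp C) C := by
  rw [← real_inner_self_eq_norm_sq, ← real_inner_smul_left, L2.inner_def, L2.inner_def]
  refine integral_mono_ae (L2.integrable_inner _ _) (L2.integrable_inner _ _) ?_
  filter_upwards [coeFn_mulL hβ.toLp C, hβ.coeFn_toLp, Lp.coeFn_smul β₀ C, h0] with x h1 h2 h3 h4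
  rw [h1, h2, h3, Pi.smul_apply, real_inner_smul_left, real_inner_smul_left]
  exact mul_le_mul_of_nonneg_right h4 real_inner_self_nonneg

/-! ### Shells -/

lemma isOpen_shell (a b : ℝ) : IsOpen (shell a b) :=
  (isOpen_lt continuous_const continuous_norm).inter (isOpen_lt continuous_norm continuous_const)

/-- Up to a null set (the centre and three spheres), the ball is the union of four shells. -/
lemma ball_ae_le_iUnion_shell {r₁ r₂ r₃ r₄ : ℝ} :
    ∀ᵐ x ∂(volume : Measure E3), x ∈ Metric.ball (0 : E3) r₄ →
      x ∈ shell 0 r₁ ∪ shell r₁ r₂ ∪ (shell r₂ r₃ ∪ shell r₃ r₄) := by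
  have hs : ∀ r : ℝ, ∀ᵐ x ∂(volume : Measure E3), ‖x‖ ≠ r := fun r => by
    have h : volume (Metric.sphere (0 : E3) r) = 0 := Measure.addHaar_sphere _ _ _
    filter_upwards [compl_mem_ae_iff.2 h] with x hx hr
    exact hx (by simpa using hr)
  filter_upwards [hs 0, hs r₁, hs r₂, hs r₃] with x h0 h1 h2 h3 hx
  have h4 : ‖x‖ < r₄ := by simpa using hx
  have hp : 0 < ‖x‖ := lt_of_le_of_ne (norm_nonneg x) (Ne.symm h0)
  rcases lt_or_gt_of_ne h1 with h | h
  · exact Or.inl (Or.inl ⟨hp, h⟩)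
  rcases lt_or_gt_of_ne h2 with h' | h'
  · exact Or.inl (Or.inr ⟨h, h'⟩)
  rcases lt_or_gt_of_ne h3 with h'' | h''
  · exact Or.inr (Or.inl ⟨h', h''⟩)
  · exact Or.inr (Or.inr ⟨h'', h4⟩)

lemma aestronglyMeasurable_and_bounds_of_shells {r₁ r₂ r₃ r₄ : ℝ} {β : E3 → ℝ} {β₀ βM : ℝ}
    (hβ : ∀ D ∈ ({shell 0 r₁, shell r₁ r₂, shell r₂ r₃, shell r₃ r₄} : Set (Set E3)),
      ContDiffOn ℝ ∞ β D ∧ ∀ x ∈ D, β₀ ≤ β x ∧ β x ≤ βM) :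
    AEStronglyMeasurable β (volume.restrict (Metric.ball (0 : E3) r₄)) ∧
      ∀ᵐ x ∂volume.restrict (Metric.ball (0 : E3) r₄), β₀ ≤ β x ∧ β x ≤ βM := by
  have h1 := hβ (shell 0 r₁) (by simp)
  have h2 := hβ (shell r₁ r₂) (by simp)
  have h3 := hβ (shell r₂ r₃) (by simp)
  have h4 := hβ (shell r₃ r₄) (by simp)
  constructor
  · have hm : ∀ a b, ContDiffOn ℝ ∞ β (shell a b) →
        AEStronglyMeasurable β (volume.restrict (shell a b)) := fun a b h =>
      h.continuousOn.aestronglyMeasurable (isOpen_shell a b).measurableSet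
    have hU : AEStronglyMeasurable β (volume.restrict
        (shell 0 r₁ ∪ shell r₁ r₂ ∪ (shell r₂ r₃ ∪ shell r₃ r₄))) := by
      simp only [aestronglyMeasurable_union_iff]
      exact ⟨⟨hm _ _ h1.1, hm _ _ h2.1⟩, hm _ _ h3.1, hm _ _ h4.1⟩
    exact hU.mono_measure (Measure.restrict_mono_ae ball_ae_le_iUnion_shell)
  · refine (ae_restrict_iff' Metric.isOpen_ball.measurableSet).2 ?_
    filter_upwards [ball_ae_le_iUnion_shell (r₁ := r₁) (r₂ := r₂) (r₃ := r₃) (r₄ := r₄)]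
      with x hx hxb
    rcases hx hxb with (h | h) | (h | h)
    · exact h1.2 x h
    · exact h2.2 x h
    · exact h3.2 x h
    · exact h4.2 x h

/-! ### The operator of the evolution equation -/

/-- The Riesz representative `∇×^* (M (∇ × v) - F v)` of the functional
`A ↦ (M (∇ × v), ∇ × A) - (F v, ∇ × A)` on `V`. -/
noncomputable def weakOperator (Ω : Set E3) (M : L2 Ω →L[ℝ] L2 Ω) (F : L2 Ω → L2 Ω) (v : V Ω) : V Ω :=
  (curl Ω).adjoint (M (curl Ω v) - F (field Ω v))

lemma inner_weakOperator {Ω : Set E3} (M : L2 Ω →L[ℝ] L2 Ω) (F : L2 Ω → L2 Ω) (v A : V Ω) :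
    inner ℝ (weakOperator Ω M F v) A
      = inner ℝ (M (curl Ω v)) (curl Ω A) - inner ℝ (F (field Ω v)) (curl Ω A) := by
  rw [weakOperator, ContinuousLinearMap.adjoint_inner_left, inner_sub_left]

lemma norm_weakOperator_sub_le {Ω : Set E3} (M : L2 Ω →L[ℝ] L2 Ω) {F : L2 Ω → L2 Ω} {K : ℝ}
    (hK : 0 ≤ K) (hF : ∀ b b', ‖F b - F b'‖ ≤ K * ‖b - b'‖) (u v : V Ω) :
    ‖weakOperator Ω M F u - weakOperator Ω M F v‖
      ≤ ‖(curl Ω).adjoint‖ * (‖M‖ + K) * ‖u - v‖ := by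
  have hsplit : weakOperator Ω M F u - weakOperator Ω M F v
      = (curl Ω).adjoint (M (curl Ω (u - v)) - (F (field Ω u) - F (field Ω v))) := by
    simp only [weakOperator, map_sub]
    abel
  have h1 : ‖M (curl Ω (u - v))‖ ≤ ‖M‖ * ‖u - v‖ :=
    (M.le_opNorm _).trans (by gcongr; exact norm_curl_le _)
  have h2 : ‖F (field Ω u) - F (field Ω v)‖ ≤ K * ‖u - v‖ := by
    refine (hF _ _).trans ?_
    rw [← map_sub]
    gcongr
    exact norm_field_le _
  rw [hsplit, mul_assoc, add_mul]
  refine (ContinuousLinearMap.le_opNorm _ _).trans ?_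
  gcongr
  exact (norm_sub_le _ _).trans (add_le_add h1 h2)

/-- Gårding's inequality: the Lipschitz term is absorbed by Young's inequality. -/
lemma weakOperator_garding {Ω : Set E3} {M : L2 Ω →L[ℝ] L2 Ω} {F : L2 Ω → L2 Ω} {K β₀ : ℝ}
    (hβ₀ : 0 < β₀) (hM : ∀ C, β₀ * ‖C‖ ^ 2 ≤ inner ℝ (M C) C)
    (hF : ∀ b b', ‖F b - F b'‖ ≤ K * ‖b - b'‖) (u v : V Ω) :
    β₀ / 2 * ‖u - v‖ ^ 2
      ≤ inner ℝ (weakOperator Ω M F u - weakOperator Ω M F v) (u - v)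
        + (K ^ 2 / (2 * β₀) + β₀ / 2) * ‖field Ω (u - v)‖ ^ 2 := by
  have hexp : inner ℝ (weakOperator Ω M F u - weakOperator Ω M F v) (u - v)
      = inner ℝ (M (curl Ω (u - v))) (curl Ω (u - v))
        - inner ℝ (F (field Ω u) - F (field Ω v)) (curl Ω (u - v)) := by
    rw [inner_sub_left, inner_weakOperator, inner_weakOperator, map_sub (curl Ω), map_sub M,
      inner_sub_left (M (curl Ω u)), inner_sub_left (F (field Ω u))]
    ring
  have h1 := hM (curl Ω (u - v))
  have h2 : inner ℝ (F (field Ω u) - F (field Ω v)) (curl Ω (u - v))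
      ≤ K * ‖field Ω (u - v)‖ * ‖curl Ω (u - v)‖ := by
    refine (real_inner_le_norm _ _).trans ?_
    rw [map_sub (field Ω)]
    gcongr
    exact hF _ _
  have h3 : K * ‖field Ω (u - v)‖ * ‖curl Ω (u - v)‖
      ≤ β₀ / 2 * ‖curl Ω (u - v)‖ ^ 2 + K ^ 2 / (2 * β₀) * ‖field Ω (u - v)‖ ^ 2 := by
    have h : β₀ / 2 * ‖curl Ω (u - v)‖ ^ 2 + K ^ 2 / (2 * β₀) * ‖field Ω (u - v)‖ ^ 2
        - K * ‖field Ω (u - v)‖ * ‖curl Ω (u - v)‖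
        = (β₀ * ‖curl Ω (u - v)‖ - K * ‖field Ω (u - v)‖) ^ 2 / (2 * β₀) := by
      field_simp
      ring
    have h' : 0 ≤ (β₀ * ‖curl Ω (u - v)‖ - K * ‖field Ω (u - v)‖) ^ 2 / (2 * β₀) := by
      positivity
    linarith
  rw [hexp, norm_sq_eq_field_add_curl]
  linarith

end Dynamo

end Coefficients

/-! ### Weak solutions as evolution equations in `V` -/

section WeakSolutions

open Filter Topology

namespace Dynamo

section WeakTimeDeriv

lemma _root_.MeasureTheory.MemLp.map_equiv {α X Y : Type*} [MeasurableSpace α] {μ : Measure α}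
    [NormedAddCommGroup X] [NormedSpace ℝ X] [NormedAddCommGroup Y] [NormedSpace ℝ Y]
    {p : ℝ≥0∞} {g : α → X} (hg : MemLp g p μ) (e : X ≃L[ℝ] Y) : MemLp (fun t => e (g t)) p μ :=
  e.toContinuousLinearMap.comp_memLp' hg

variable {X Y : Type*} [NormedAddCommGroup X] [NormedSpace ℝ X] [NormedAddCommGroup Y]
  [NormedSpace ℝ Y] {T : ℝ} {g g' h h' : ℝ → X}

lemma IsWeakTimeDeriv.congr (hg : IsWeakTimeDeriv T g g') (e : g =ᵐ[timeMeasure T] h)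
    (e' : g' =ᵐ[timeMeasure T] h') : IsWeakTimeDeriv T h h' := by
  intro φ h1 h2 h3
  have a1 : ∫ t in Ioo 0 T, deriv φ t • h t = ∫ t in Ioo 0 T, deriv φ t • g t :=
    integral_congr_ae (by filter_upwards [e] with t ht; rw [ht])
  have a2 : ∫ t in Ioo 0 T, φ t • h' t = ∫ t in Ioo 0 T, φ t • g' t :=
    integral_congr_ae (by filter_upwards [e'] with t ht; rw [ht])
  rw [a1, a2]
  exact hg φ h1 h2 h3

lemma IsWeakTimeDeriv.map_equiv (hg : IsWeakTimeDeriv T g g') (e : X ≃L[ℝ] Y) :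
    IsWeakTimeDeriv T (fun t => e (g t)) (fun t => e (g' t)) := by
  intro φ h1 h2 h3
  simp only [← map_smul]
  rw [e.integral_comp_comm, e.integral_comp_comm, hg φ h1 h2 h3, map_neg]

lemma IsWeakTimeDeriv.sub (hg : IsWeakTimeDeriv T g g') (hh : IsWeakTimeDeriv T h h')
    (mg : MemLp g 2 (timeMeasure T)) (mg' : MemLp g' 2 (timeMeasure T))
    (mh : MemLp h 2 (timeMeasure T)) (mh' : MemLp h' 2 (timeMeasure T)) :
    IsWeakTimeDeriv T (fun t => g t - h t) (fun t => g' t - h' t) := by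
  intro φ h1 h2 h3
  have m1 : MemLp φ 2 (timeMeasure T) := h1.continuous.memLp_of_hasCompactSupport h2
  have m2 : MemLp (deriv φ) 2 (timeMeasure T) :=
    (h1.continuous_deriv (by simp)).memLp_of_hasCompactSupport h2.deriv
  simp only [smul_sub]
  rw [integral_sub (m2.integrable_smul_two mg) (m2.integrable_smul_two mh),
    integral_sub (m1.integrable_smul_two mg') (m1.integrable_smul_two mh'),
    hg φ h1 h2 h3, hh φ h1 h2 h3]
  abel

end WeakTimeDeriv

section Riesz

variable {E : Type*} [NormedAddCommGroup E] [InnerProductSpace ℝ E] [CompleteSpace E]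

variable (E) in
/-- The Riesz isomorphism `w ↦ (w, ·)` between a real Hilbert space and its dual. -/
noncomputable def riesz : E ≃L[ℝ] (E →L[ℝ] ℝ) :=
  { InnerProductSpace.toDual ℝ E with
    map_smul' := fun c w => by
      ext A
      simp
    continuous_toFun := (InnerProductSpace.toDual ℝ E).continuous
    continuous_invFun := (InnerProductSpace.toDual ℝ E).symm.continuous }

@[simp]
lemma riesz_apply (w A : E) : riesz E w A = inner ℝ w A := rfl

lemma memLp_riesz_iff {α : Type*} [MeasurableSpace α] {μ : Measure α} {p : ℝ≥0∞} {w : α → E} :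
    MemLp (fun t => riesz E (w t)) p μ ↔ MemLp w p μ :=
  ⟨fun h => by simpa using h.map_equiv (riesz E).symm, fun h => h.map_equiv (riesz E)⟩

lemma isWeakTimeDeriv_riesz_iff {T : ℝ} {w w' : ℝ → E} :
    IsWeakTimeDeriv T (fun t => riesz E (w t)) (fun t => riesz E (w' t)) ↔
      IsWeakTimeDeriv T w w' :=
  ⟨fun h => by simpa using h.map_equiv (riesz E).symm, fun h => h.map_equiv (riesz E)⟩

/-- An `L²` weak derivative in the dual space with prescribed Riesz representatives `w'`
amounts to an `L²` weak derivative of the representatives. -/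
lemma exists_isWeakTimeDeriv_riesz_iff {T : ℝ} {w w' : ℝ → E} :
    (∃ B' : Lp (E →L[ℝ] ℝ) 2 (timeMeasure T), IsWeakTimeDeriv T (fun t => riesz E (w t)) B' ∧
        ∀ᵐ t ∂timeMeasure T, B' t = riesz E (w' t)) ↔
      MemLp w' 2 (timeMeasure T) ∧ IsWeakTimeDeriv T w w' := by
  constructor
  · rintro ⟨B', hw, hB'⟩
    exact ⟨memLp_riesz_iff.1 ((Lp.memLp B').ae_eq hB'),
      isWeakTimeDeriv_riesz_iff.1 (hw.congr .rfl hB')⟩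
  · rintro ⟨hm, hw⟩
    have hm' := memLp_riesz_iff.2 hm
    exact ⟨hm'.toLp, (isWeakTimeDeriv_riesz_iff.2 hw).congr .rfl hm'.coeFn_toLp.symm,
      hm'.coeFn_toLp⟩

end Riesz

lemma pivot_eq_riesz {Ω : Set E3} (B : V Ω) : pivot Ω B = riesz (V Ω) (pivotOp (field Ω) B) := by
  ext A
  rw [riesz_apply, inner_pivotOp_left]
  rfl

/-- The operator `n(t)` of the evolution equation `(j^* j B)' + n(t) B = 0` in `V`, where `j` is
the inclusion of `V` into `L²(Ω)³`. -/
noncomputable def evolutionOperator (Ω : Set E3) {β : E3 → ℝ}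
    (hβ : MemLp β ⊤ (volume.restrict Ω)) (Rα Rm : ℝ) {σ : ℝ} (hσ : 0 ≤ σ)
    (f : ℝ → Lp ℝ ⊤ (volume.restrict Ω)) (u : ℝ → Lp E3 ⊤ (volume.restrict Ω)) (t : ℝ) :
    V Ω → V Ω :=
  weakOperator Ω (mulL Ω hβ.toLp) (emf Ω Rα Rm hσ (f t) (u t))

/-- The weak formulation, tested with all `A ∈ V`, states that the Riesz representative of `B'` is
`-n(t) B`. -/
lemma isWeakSolution_iff {Ω : Set E3} {T : ℝ} {β : E3 → ℝ}
    (hβ : MemLp β ⊤ (volume.restrict Ω)) {Rα Rm σ : ℝ} (hσ : 0 ≤ σ)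
    {f : ℝ → Lp ℝ ⊤ (volume.restrict Ω)} {u : ℝ → Lp E3 ⊤ (volume.restrict Ω)} {B₀ : L2 Ω}
    {B : Lp (V Ω) 2 (timeMeasure T)} :
    IsWeakSolution Ω T β Rα Rm σ f u B₀ B ↔
      (MemLp (fun t => evolutionOperator Ω hβ Rα Rm hσ f u t (B t)) 2 (timeMeasure T) ∧
        IsWeakTimeDeriv T (fun t => pivotOp (field Ω) (B t))
          (fun t => -evolutionOperator Ω hβ Rα Rm hσ f u t (B t))) ∧
      ∃ Bc : ℝ → L2 Ω, ContinuousOn Bc (Icc 0 T) ∧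
        (∀ᵐ t ∂timeMeasure T, Bc t = field Ω (B t)) ∧ Bc 0 = B₀ := by
  have heq : ∀ (t : ℝ) (b' : U Ω) (b : V Ω),
      (∀ A : V Ω, b' A + ∫ x in Ω, β x * inner ℝ (curl Ω b x) (curl Ω A x)
        = source Ω Rα Rm σ (f t) (u t) b A) ↔
      b' = riesz (V Ω) (-evolutionOperator Ω hβ Rα Rm hσ f u t b) := by
    intro t b' b
    rw [ContinuousLinearMap.ext_iff]
    refine forall_congr' fun A => ?_
    rw [riesz_apply, inner_neg_left, evolutionOperator, inner_weakOperator,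
      source_eq_inner_emf Rα Rm hσ, inner_mulL hβ]
    constructor <;> intro h <;> linarith
  unfold IsWeakSolution
  refine and_congr_left fun _ => ?_
  simp only [heq, pivot_eq_riesz]
  rw [exists_isWeakTimeDeriv_riesz_iff]
  exact and_congr_left fun _ => memLp_neg_iff

end Dynamo

end WeakSolutions

/-! ### Well-posedness -/

section WellPosedness

open Dynamo Filter

theorem mainTheorem2
    (r₁ r₂ r₃ r₄ : ℝ) (hr₁ : 0 < r₁) (hr₂ : r₁ < r₂) (hr₃ : r₂ < r₃) (hr₄ : r₃ < r₄)
    (Ω : Set Dynamo.E3) (hΩ : Ω = Metric.ball 0 r₄)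
    (T : ℝ) (hT : 0 < T) (Rα Rm σ : ℝ) (hσ : 0 ≤ σ)
    (β : Dynamo.E3 → ℝ) (β₀ βM : ℝ) (hβ₀ : 0 < β₀)
    (hβ : ∀ D ∈ ({Dynamo.shell 0 r₁, Dynamo.shell r₁ r₂, Dynamo.shell r₂ r₃,
        Dynamo.shell r₃ r₄} : Set (Set Dynamo.E3)),
      ContDiffOn ℝ ∞ β D ∧ ∀ x ∈ D, β₀ ≤ β x ∧ β x ≤ βM)
    (f : ℝ → Lp ℝ ⊤ (volume.restrict Ω)) (hf : Dynamo.MemH1Time T f)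
    (hf_supp : ∀ᵐ t ∂(Dynamo.timeMeasure T), ∀ᵐ x ∂(volume.restrict Ω),
      x ∉ Dynamo.shell r₂ r₃ → f t x = 0)
    (u : ℝ → Lp Dynamo.E3 ⊤ (volume.restrict Ω)) (hu : Dynamo.MemH1Time T u)
    (hu_supp : ∀ᵐ t ∂(Dynamo.timeMeasure T), ∀ᵐ x ∂(volume.restrict Ω),
      x ∉ Dynamo.shell r₁ r₂ → u t x = 0)
    (B₀ : Dynamo.L2 Ω) (hB₀ : Dynamo.IsDivFree Ω B₀) :
    ∃! B : Lp (Dynamo.V Ω) 2 (Dynamo.timeMeasure T),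
      Dynamo.IsWeakSolution Ω T β Rα Rm σ f u B₀ B := by
  obtain ⟨hβm, hβb⟩ := aestronglyMeasurable_and_bounds_of_shells hβ
  rw [← hΩ] at hβm hβb
  have hβL : MemLp β ⊤ (volume.restrict Ω) := by
    refine memLp_top_of_bound hβm βM ?_
    filter_upwards [hβb] with x hx
    rw [Real.norm_of_nonneg (hβ₀.le.trans hx.1)]
    exact hx.2
  have hdense : DenseRange (field Ω) := denseRange_field (hΩ ▸ Metric.isOpen_ball)
  obtain ⟨Cf, hCf⟩ := hf.exists_ae_bound hT
  obtain ⟨Cu, hCu⟩ := hu.exists_ae_bound hT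
  set M := mulL Ω hβL.toLp with hM
  set n := evolutionOperator Ω hβL Rα Rm hσ f u with hn
  -- the signs of the bounds `Cf` and `Cu` are not known, hence the absolute values
  set K := |Rα| * (‖mulL Ω‖ * |Cf| * 3) + |Rm| * (‖crossLpL Ω‖ * |Cu|) with hK
  have hK0 : 0 ≤ K := by positivity
  have hF : ∀ᵐ t ∂timeMeasure T, ∀ b b',
      ‖emf Ω Rα Rm hσ (f t) (u t) b - emf Ω Rα Rm hσ (f t) (u t) b'‖ ≤ K * ‖b - b'‖ := by
    filter_upwards [hCf, hCu] with t h1 h2 b b'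
    exact norm_emf_sub_le Rα Rm hσ (h1.trans (le_abs_self _)) (h2.trans (le_abs_self _)) b b'
  have hmono : ∀ᵐ t ∂timeMeasure T, ∀ v w : V Ω, β₀ / 2 * ‖v - w‖ ^ 2
      ≤ inner ℝ (n t v - n t w) (v - w)
        + (K ^ 2 / (2 * β₀) + β₀ / 2) * ‖field Ω (v - w)‖ ^ 2 := by
    filter_upwards [hF] with t ht v w
    exact weakOperator_garding hβ₀ (le_inner_mulL hβL (hβb.mono fun x hx => hx.1)) ht v w
  have hLip : ∀ᵐ t ∂timeMeasure T, ∀ v w : V Ω,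
      ‖n t v - n t w‖ ≤ ‖(curl Ω).adjoint‖ * (‖M‖ + K) * ‖v - w‖ := by
    filter_upwards [hF] with t ht v w
    exact norm_weakOperator_sub_le M hK0 ht v w
  have hmeas : ∀ v : ℝ → V Ω, AEStronglyMeasurable v (timeMeasure T) →
      AEStronglyMeasurable (fun t => n t (v t)) (timeMeasure T) := by
    intro v hv
    have h1 : AEStronglyMeasurable (fun t => M (curl Ω (v t))) (timeMeasure T) :=
      (M.comp (curl Ω)).continuous.comp_aestronglyMeasurable hv
    have h2 : AEStronglyMeasurable (fun t => emf Ω Rα Rm hσ (f t) (u t) (field Ω (v t)))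
        (timeMeasure T) := by
      have hv' : AEStronglyMeasurable (fun t => field Ω (v t)) (timeMeasure T) :=
        (field Ω).continuous.comp_aestronglyMeasurable hv
      exact (continuous_emf Rα Rm hσ).comp_aestronglyMeasurable
        (f := fun t => ((f t, u t), field Ω (v t))) ((hf.1.1.prodMk hu.1.1).prodMk hv')
    exact (curl Ω).adjoint.continuous.comp_aestronglyMeasurable (h1.sub h2)
  have hn0 : ∀ t, n t 0 = 0 := fun t => by
    simp [hn, evolutionOperator, weakOperator, emf_zero]
  obtain ⟨v, hv, hnv, hvw, x, hxc, hx0, hx⟩ := exists_solution_of_garding hdense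
    (half_pos hβ₀) hmeas (Eventually.of_forall hn0) hLip hmono B₀
  refine ⟨hv.toLp, (isWeakSolution_iff hβL hσ).2 ⟨⟨?_, ?_⟩, x, hxc.continuousOn, ?_, hx0⟩,
    fun B hB => ?_⟩
  · refine hnv.ae_eq ?_
    filter_upwards [hv.coeFn_toLp] with t ht
    rw [ht]
  · refine hvw.congr ?_ ?_
    · filter_upwards [hv.coeFn_toLp] with t ht
      rw [ht]
    · filter_upwards [hv.coeFn_toLp] with t ht
      rw [ht]
  · filter_upwards [hv.coeFn_toLp, hx] with t ht hxt
    rw [ht, hxt]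
  · obtain ⟨⟨hnB, hBw⟩, y, hyc, hy, hy0⟩ := (isWeakSolution_iff hβL hσ).1 hB
    have hpv := (pivotOp (field Ω)).comp_memLp' hv
    have hpB := (pivotOp (field Ω)).comp_memLp' (Lp.memLp B)
    have hzg := hBw.sub hvw hpB hnB.neg hpv hnv.neg
    have hz0 := ae_eq_zero_of_garding (j := field Ω) hT (half_pos hβ₀) ((Lp.memLp B).sub hv)
      (hnB.neg.sub hnv.neg) (l := K ^ 2 / (2 * β₀) + β₀ / 2)
      (hzg.congr (.of_forall fun t => (map_sub _ _ _).symm) .rfl)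
      (hyc.sub hxc.continuousOn) (by rw [Pi.sub_apply, hy0, hx0, sub_self])
      (by
        filter_upwards [hy, hx] with t h1 h2
        rw [Pi.sub_apply, Pi.sub_apply, h1, h2, map_sub])
      (by
        filter_upwards [hmono] with t ht
        have h := ht (B t) (v t)
        have e : inner ℝ (-n t (B t) - -n t (v t)) (B t - v t)
            = -inner ℝ (n t (B t) - n t (v t)) (B t - v t) := by
          rw [← inner_neg_left]
          congr 1
          abel
        simp only [Pi.sub_apply, Pi.neg_apply]
        rw [e]
        linarith)
    refine Lp.ext ?_
    filter_upwards [hz0, hv.coeFn_toLp] with t ht h2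
    rw [h2]
    exact sub_eq_zero.1 ht

end WellPosedness
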